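/- Let $J\ge 1$, $N=2^J$, and let $\mathbf C^{\mathrm{II}}_N=\sqrt{2/N}\,\bigl(\varepsilon_N(k)\cos\tfrac{k(2l+1)\pi}{2N}\bigr)_{k,l=0}^{N-1}$ with $\varepsilon_N(k)=1/\sqrt2$ for $N\mid k$ and $\varepsilon_N(k)=1$ otherwise, and $x^{\widehat{\mathrm{II}}}=\mathbf C^{\mathrm{II}}_N x$. A vector $x\in\mathbb R^N$ has a short support of length $m\ge 1$ with first index $\mu$ and last index $\nu=\mu+m-1$ if $x_\mu\ne0$, $x_\nu\neq 0$ and $x_k=0$ for $k\notin\{\mu,\dots,\nu\}$. Put $x^{(J)}=x$ and, for $0\le j<J$, $x^{(j)}_k=x^{(j+1)}_k+x^{(j+1)}_{2^{j+1}-1-k}$ ($0\le k<2^j$). Consider the following algorithm with input $m$, a threshold $\varepsilon\ge 0$ and query access to the entries of $x^{\widehat{\mathrm{II}}}$. Let $L=\min(\lceil\log_2 m\rceil+1,\,J)$. Vectors are stored through their first support index $\mu^{(j)}$, support length $m^{(j)}$ and the entries on the support interval. "Finding the support" of a vector (of a window of it) means taking the first and the last index at which its modulus exceeds $\varepsilon$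 (if there is none, the interval consisting of the first index of the window is used). 1. Compute $x^{(L)}=(\mathbf C^{\mathrm{II}}_{2^L})^{T}\bigl(\sqrt2^{\,J-L}x^{\widehat{\mathrm{II}}}_{2^{J-L}k}\bigr)_{k=0}^{2^L-1}$ by a fast DCT-III and find its support. 2. For $j=L,\dots,J-1$: (a) If $\mu^{(j)}<2^j-m$: among the numbers $\sqrt2^{\,J-j-1}x^{\widehat{\mathrm{II}}}_{2^{J-j-1}(2k+1)}$, $0\le k<m^{(j)}$, choose one of largest modulus, $\alpha$, with index $k_0$. Compute $u=2^{-j/2}\sum_{l=0}^{m^{(j)}-1}\cos\bigl(\tfrac{(2k_0+1)(2(\mu^{(j)}+l)+1)\pi}{2\cdot2^{j+1}}\bigr)x^{(j)}_{\mu^{(j)}+l}$. If $|u-\alpha|<|u+\alpha|$, let $x^{(j+1)}$ be $x^{(j)}$ followed by $2^j$ zeros; otherwise let $x^{(j+1)}$ be $2^j$ zeros followed by the reversal of $x^{(j)}$. (b) Otherwise let $q=\lceil\log_2(2^j-\mu^{(j)})\rceil$, $\tilde K=q+1$, $z=(x^{(j)}_{2^j-2^{q}+k})_{k=0}^{2^{q}-1}$,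 $b^{0},b^{1}=\sqrt2^{\,J-j-1}\bigl(x^{\widehat{\mathrm{II}}}_{2^{J-\tilde K}(2p+1)\pm2^{J-j-1}}\bigr)_{p=0}^{2^{q}-1}$ ($+$ for $b^0$), and, with $R$ the reversal of vectors of length $2^q$ and $\mathbf C^{\mathrm{IV}}_n=\sqrt{2/n}\,(\cos\tfrac{(2k+1)(2l+1)\pi}{4n})_{k,l=0}^{n-1}$, compute by a fast DCT-IV $$z_0=\tfrac12\sqrt{2^{j-\tilde K}}\,(-1)^{2^{j-\tilde K}}R\,\mathrm{diag}\Bigl(\tfrac{(-1)^l}{\cos((2l+1)\pi/(4\cdot2^j))}\Bigr)_{l}\mathbf C^{\mathrm{IV}}_{2^{q}}R(b^0-b^1)+\tfrac12 z .$$ Replace by $0$ the entries of $z_0$ of modulus at most $\varepsilon$, put $z_1=R(z-z_0)$, let $x^{(j+1)}$ have the entries $(z_0,z_1)$ at the positions $2^j-2^{q},\dots,2^j+2^{q}-1$ and zeros elsewhere, and find its support in this window. 3. Return $x^{(J)}$. The fast DCT-III of length $n=2^q$ is the radix-2 recursion that reduces it to a DCT-III and a DCT-IV of length $n/2$, a DCT-IV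 being reduced to a DCT-III of the same length by back substitution and multiplication by cosines. Running time is the number of executed unit-cost instructions of a real random access machine (real arithmetic, square roots, cosines of rational multiples of $\pi$, integer constants, comparisons, sample queries, loop passes and stores); address computations and operand fetches are part of an instruction. **Theorem.** There is an absolute constant $C>0$ such that for all $J\ge1$, $N=2^J$, all $m$, all $x\in\mathbb R^N$ with a short support of length $m$ satisfying $x_\mu+x_\nu\ne0$ if $m$ is even, and all $\varepsilon\ge0$, the algorithm run with the exact support length $m$ takes time at most $C\bigl(m\log m+m\log_2\frac Nm\bigr)$ and reads at most $C\bigl(m+m\log_2\frac Nm\bigr)$ samples of $x^{\widehat{\mathrm{II}}}$; moreover it returns $x$ whenever $\varepsilon$ is smaller than the modulus of every nonzero entry of $x^{(L)},\dots,x^{(J)}$ (in particular for $\varepsilon=0$). -/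

import Mathlib

/-! ### Cosine transform, short support, reflected periodizations -/

/-- The weight `ε_n(k)`: it is `1/√2` if `n` divides `k` and `1` otherwise. -/
noncomputable def cosineWeight (n k : ℕ) : ℝ := if n ∣ k then 1 / √2 else 1

/-- The cosine matrix of type II, `√(2/n) (ε_n(k) cos(k(2l+1)π/(2n)))` with rows `k`, columns `l`. -/
noncomputable def cosineMatrixII (n : ℕ) : Matrix (Fin n) (Fin n) ℝ :=
  Matrix.of fun k l =>
    √(2 / n) * (cosineWeight n k * Real.cos (k * (2 * l + 1) * Real.pi / (2 * n)))

/-- The discrete cosine transform of type II. -/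
noncomputable def dctII {n : ℕ} (x : Fin n → ℝ) : Fin n → ℝ :=
  Matrix.mulVec (cosineMatrixII n) x

/-- A vector as a function on `ℕ`, with value `0` outside the index range. -/
def zeroExtend {n : ℕ} (x : Fin n → ℝ) (k : ℕ) : ℝ :=
  if h : k < n then x ⟨k, h⟩ else 0

/-- `x` has a short support of length `m` with first support index `μ` and last one `ν`. -/
structure IsShortSupport {n : ℕ} (x : Fin n → ℝ) (m : ℕ) (μ ν : Fin n) : Prop where
  le : μ ≤ ν
  length_eq : (ν : ℕ) + 1 = μ + m
  first_ne : x μ ≠ 0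
  last_ne : x ν ≠ 0
  zero_outside : ∀ k, k < μ ∨ ν < k → x k = 0

/-- `reflectedPeriodization J x d` is the reflected periodization `x^(J-d)`, a vector of length
`2^(J-d)` extended by zero: the first half of `x^(J-d+1)` plus the reversed second half. -/
def reflectedPeriodization (J : ℕ) (x : Fin (2 ^ J) → ℝ) : ℕ → ℕ → ℝ
  | 0 => zeroExtend x
  | d + 1 => fun k =>
      if k < 2 ^ (J - (d + 1)) then
        reflectedPeriodization J x d k + reflectedPeriodization J x d (2 ^ (J - d) - 1 - k)
      else 0

/-! ### A real random access machine with a sample oracle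

Programs are polymorphic in the type `R` of real numbers, so that the only way to produce, combine
or compare reals is through the instructions below. Each instruction takes one unit of time; this
includes fetching its operands from memory and computing their addresses. -/

/-- The binary arithmetic instructions. -/
inductive ArithOp
  | add
  | sub
  | mul
  | div

/-- The meaning of an arithmetic instruction. -/
noncomputable def ArithOp.apply : ArithOp → ℝ → ℝ → ℝ
  | .add, x, y => x + y
  | .sub, x, y => x - y
  | .mul, x, y => x * y
  | .div, x, y => x / y

/-- Programs with real numbers in `R` and a result in `α`. Every constructor but `ret` is one
instruction followed by the rest of the program:
`arith o x y` is an arithmetic operation, `const n` loads the integer `n`, `sqrt x` is `√x`,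
`cosPi p q` is `cos (pπ/q)`, `sample i` reads entry `i` of the given data, `less x y` decides
`x < y`, and `tick` is one step of bookkeeping (a loop pass, a store, an integer operation). -/
inductive Prog (R α : Type) : Type
  | ret (a : α)
  | arith (o : ArithOp) (x y : R) (k : R → Prog R α)
  | const (n : ℕ) (k : R → Prog R α)
  | sqrt (x : R) (k : R → Prog R α)
  | cosPi (p q : ℕ) (k : R → Prog R α)
  | sample (i : ℕ) (k : R → Prog R α)
  | less (x y : R) (k : Bool → Prog R α)
  | tick (k : Prog R α)

namespace Prog

/-- Sequential composition. -/
def andThen {R α β : Type} : Prog R α → (α → Prog R β) → Prog R β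
  | .ret a, f => f a
  | .arith o x y k, f => .arith o x y fun r => andThen (k r) f
  | .const n k, f => .const n fun r => andThen (k r) f
  | .sqrt x k, f => .sqrt x fun r => andThen (k r) f
  | .cosPi p q k, f => .cosPi p q fun r => andThen (k r) f
  | .sample i k, f => .sample i fun r => andThen (k r) f
  | .less x y k, f => .less x y fun b => andThen (k b) f
  | .tick k, f => .tick (andThen k f)

instance {R : Type} : Monad (Prog R) where
  pure := .ret
  bind := andThen

/-- The result of a program on the data `b`, in exact real arithmetic. -/
noncomputable def eval {α : Type} (b : ℕ → ℝ) : Prog ℝ α → α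
  | .ret a => a
  | .arith o x y k => eval b (k (o.apply x y))
  | .const n k => eval b (k n)
  | .sqrt x k => eval b (k √x)
  | .cosPi p q k => eval b (k (Real.cos (p * Real.pi / q)))
  | .sample i k => eval b (k (b i))
  | .less x y k => eval b (k (decide (x < y)))
  | .tick k => eval b k

/-- The running time of a program on the data `b`: the number of instructions executed. -/
noncomputable def time {α : Type} (b : ℕ → ℝ) : Prog ℝ α → ℕ
  | .ret _ => 0
  | .arith o x y k => time b (k (o.apply x y)) + 1
  | .const n k => time b (k n) + 1
  | .sqrt x k => time b (k √x) + 1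
  | .cosPi p q k => time b (k (Real.cos (p * Real.pi / q))) + 1
  | .sample i k => time b (k (b i)) + 1
  | .less x y k => time b (k (decide (x < y))) + 1
  | .tick k => time b k + 1

/-- The number of samples of the data `b` that a program reads, with repetitions. -/
noncomputable def samples {α : Type} (b : ℕ → ℝ) : Prog ℝ α → ℕ
  | .ret _ => 0
  | .arith o x y k => samples b (k (o.apply x y))
  | .const n k => samples b (k n)
  | .sqrt x k => samples b (k √x)
  | .cosPi p q k => samples b (k (Real.cos (p * Real.pi / q)))
  | .sample i k => samples b (k (b i)) + 1
  | .less x y k => samples b (k (decide (x < y)))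
  | .tick k => samples b k

section Basic

variable {R : Type}

/-- Sum. -/
def plus (x y : R) : Prog R R := .arith .add x y .ret
/-- Difference. -/
def minus (x y : R) : Prog R R := .arith .sub x y .ret
/-- Product. -/
def times (x y : R) : Prog R R := .arith .mul x y .ret
/-- Quotient. -/
def quot (x y : R) : Prog R R := .arith .div x y .ret
/-- The integer constant `n`. -/
def natConst (n : ℕ) : Prog R R := .const n .ret
/-- The number `√n` for an integer constant `n`. -/
def sqrtConst (n : ℕ) : Prog R R := .const n fun r => .sqrt r .ret
/-- The number `cos (pπ/q)`. -/
def cosine (p q : ℕ) : Prog R R := .cosPi p q .ret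
/-- Entry `i` of the data. -/
def query (i : ℕ) : Prog R R := .sample i .ret
/-- The truth value of `x < y`. -/
def isLess (x y : R) : Prog R Bool := .less x y .ret
/-- `n` steps of bookkeeping. -/
def ticks : ℕ → Prog R Unit
  | 0 => .ret ()
  | n + 1 => .tick (ticks n)

/-- The absolute value `|x|`. -/
def absolute (x : R) : Prog R R := do
  let z ← natConst 0
  if (← isLess x z) then minus z x else return x

/-- A loop over `i = 0, …, n-1` with loop state `s`. -/
def loop {σ : Type} : (n : ℕ) → (Fin n → σ → Prog R σ) → σ → Prog R σ
  | 0, _, s => .ret s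
  | n + 1, body, s => do
    let s ← loop n (fun i => body i.castSucc) s
    ticks 1
    body (Fin.last n) s

/-- Computes and stores an array of length `n` entry by entry. -/
def tabulate : (n : ℕ) → (Fin n → Prog R R) → Prog R (Fin n → R)
  | 0, _ => .ret Fin.elim0
  | n + 1, entry => do
    let v ← tabulate n (fun i => entry i.castSucc)
    let y ← entry (Fin.last n)
    ticks 1
    return Fin.snoc v y

end Basic

end Prog

/-! ### Fast cosine transforms of length `2^q` in real arithmetic -/

section FastTransforms

variable {R : Type}

open Prog

/-- The solution `v` of `v_i + v_{i+1} = w_i`, `v_n = 0`, by back substitution; the first component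
of the result is `v_0`. -/
def backSubst : (n : ℕ) → (Fin n → R) → Prog R (R × (Fin n → R))
  | 0, _ => do
    let z ← natConst 0
    return (z, Fin.elim0)
  | n + 1, w => do
    let (h, v) ← backSubst n (Fin.tail w)
    let y ← minus (w 0) h
    ticks 1
    return (y, Fin.cons y v)

/-- Given a program for `v ↦ (∑_k cos(k(2l+1)π/(2n)) v_k)_l` with `n = 2^q`, a program for the
unnormalized DCT-IV `w ↦ (∑_k cos((2k+1)(2l+1)π/(4n)) w_k)_l`. -/
def rawFourFromThree (q : ℕ) (three : (Fin (2 ^ q) → R) → Prog R (Fin (2 ^ q) → R))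
    (w : Fin (2 ^ q) → R) : Prog R (Fin (2 ^ q) → R) := do
  let (_, v) ← backSubst (2 ^ q) w
  let two ← natConst 2
  let v' ← tabulate (2 ^ q) fun i => if (i : ℕ) = 0 then quot (v i) two else return v i
  let c ← three v'
  tabulate (2 ^ q) fun l => do
    let t ← cosine (2 * l + 1) (4 * 2 ^ q)
    let s ← times two t
    times s (c l)

/-- The unnormalized fast DCT-III `v ↦ (∑_k cos(k(2l+1)π/(2n)) v_k)_l` of length `n = 2^q`, by
splitting `v` into its evenly and its oddly indexed entries. -/
def rawThree : (q : ℕ) → (Fin (2 ^ q) → R) → Prog R (Fin (2 ^ q) → R)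
  | 0, v => return v
  | q + 1, v => do
    let e ← tabulate (2 ^ q) fun i => return v ⟨2 * i, by rw [pow_succ]; omega⟩
    let o ← tabulate (2 ^ q) fun i => return v ⟨2 * i + 1, by rw [pow_succ]; omega⟩
    let a ← rawThree q e
    let b ← rawFourFromThree q (rawThree q) o
    tabulate (2 ^ (q + 1)) fun l =>
      if h : (l : ℕ) < 2 ^ q then plus (a ⟨l, h⟩) (b ⟨l, h⟩)
      else
        have h' : 2 ^ (q + 1) - 1 - (l : ℕ) < 2 ^ q := by
          have hl := l.2
          have hp : 2 ^ (q + 1) = 2 * 2 ^ q := by ring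
          omega
        minus (a ⟨2 ^ (q + 1) - 1 - l, h'⟩) (b ⟨2 ^ (q + 1) - 1 - l, h'⟩)

/-- The fast (orthonormal) DCT-III of length `2^q`, that is the product with the transpose of the
cosine matrix of type II. -/
def fastDCT3 (q : ℕ) (v : Fin (2 ^ q) → R) : Prog R (Fin (2 ^ q) → R) := do
  let two ← natConst 2
  let n ← natConst (2 ^ q)
  let scale ← (do Prog.sqrt (← quot two n) .ret)
  let root ← sqrtConst 2
  let v' ← tabulate (2 ^ q) fun i => if (i : ℕ) = 0 then quot (v i) root else return v i
  let y ← rawThree q v'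
  tabulate (2 ^ q) fun l => times scale (y l)

/-- The fast (orthonormal) DCT-IV of length `2^q`, that is the product with
`√(2/n) (cos((2k+1)(2l+1)π/(4n)))`, `n = 2^q`. -/
def fastDCT4 (q : ℕ) (w : Fin (2 ^ q) → R) : Prog R (Fin (2 ^ q) → R) := do
  let two ← natConst 2
  let n ← natConst (2 ^ q)
  let scale ← (do Prog.sqrt (← quot two n) .ret)
  let y ← rawFourFromThree q (rawThree q) w
  tabulate (2 ^ q) fun l => times scale (y l)

end FastTransforms

/-! ### The sparse fast inverse DCT-II -/

/-- A vector that vanishes outside the interval `start, …, start + len - 1`, given by its entries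
on that interval. -/
structure Block (R : Type) where
  start : ℕ
  len : ℕ
  val : Fin len → R

/-- Entry `k` of the vector given by a block. -/
def Block.entry (B : Block ℝ) (k : ℕ) : ℝ :=
  if h : B.start ≤ k ∧ k < B.start + B.len then B.val ⟨k - B.start, by omega⟩ else 0

section SparseTransform

variable {R : Type}

open Prog

/-- Reads entry `k` of the vector given by a block. -/
def Block.read (B : Block R) (k : ℕ) : Prog R R :=
  if h : B.start ≤ k ∧ k < B.start + B.len then return B.val ⟨k - B.start, by omega⟩
  else natConst 0

/-- Finds the first and the last index `i` with `|w_i| > ε` and returns `w` restricted to the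
interval between them, where `w_0` is the entry at position `offset` of the full vector. (If there
is no such index, the interval `{0}` is used.) -/
def findSupport (offset n : ℕ) (w : Fin n → R) (ε : R) : Prog R (Block R) := do
  let found ← loop n (fun i (s : Option (ℕ × ℕ)) => do
    if (← isLess ε (← absolute (w i))) then
      match s with
      | none => return some ((i : ℕ), (i : ℕ))
      | some (f, _) => return some (f, (i : ℕ))
    else return s) none
  let first := (found.getD (0, 0)).1
  let last := (found.getD (0, 0)).2
  let v ← tabulate (last + 1 - first) fun i =>
    if h : first + (i : ℕ) < n then return w ⟨first + i, h⟩ else natConst 0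
  return ⟨offset + first, last + 1 - first, v⟩

/-- Lines 1 and 2: computes `x^(L)` by a DCT-III of length `2^L` and finds its support. -/
def initialStep (J L : ℕ) (ε : R) : Prog R (Block R) := do
  let r ← sqrtConst (2 ^ (J - L))
  let a ← tabulate (2 ^ L) fun k => do times r (← query (2 ^ (J - L) * k))
  let y ← fastDCT3 L a
  findSupport 0 (2 ^ L) y ε

/-- The step from `x^(j)` to `x^(j+1)` when there is no collision. Among the first `len` oddly
indexed entries of the DCT-II of `x^(j+1)`, one of largest modulus is chosen as `α`, with index
`2 k₀ + 1`; it decides whether `x^(j+1)` is `x^(j)` followed by zeros, or zeros followed by the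
reversed `x^(j)`. -/
def stepNoCollision (J j : ℕ) (B : Block R) : Prog R (Block R) := do
  let zero ← natConst 0
  let r ← sqrtConst (2 ^ (J - j - 1))
  let (k₀, α, _) ← loop B.len (fun k (s : ℕ × R × R) => do
    let y ← times r (← query (2 ^ (J - j - 1) * (2 * k + 1)))
    let t ← absolute y
    if (← isLess s.2.2 t) then return ((k : ℕ), y, t) else return s) (0, zero, zero)
  let sum ← loop B.len (fun l (s : R) => do
    let c ← cosine ((2 * k₀ + 1) * (2 * (B.start + l) + 1)) (2 * 2 ^ (j + 1))
    plus s (← times c (B.val l))) zero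
  let u ← quot sum (← sqrtConst (2 ^ j))
  let d₀ ← absolute (← minus u α)
  let d₁ ← absolute (← plus u α)
  if (← isLess d₀ d₁) then return B
  else do
    let v ← tabulate B.len fun i => return B.val i.rev
    return ⟨2 ^ (j + 1) - B.len - B.start, B.len, v⟩

/-- The step from `x^(j)` to `x^(j+1)` when there may be a collision. Here `2^q` with
`q = ⌈log₂(2^j - start)⌉` is the length of the restricted vectors `z`, `z₀`, `z₁`, so `q + 1` is
the number written `K` with a tilde. -/
def stepCollision (J j : ℕ) (ε : R) (B : Block R) : Prog R (Block R) := do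
  let q := Nat.clog 2 (2 ^ j - B.start)
  ticks (q + 1)
  let z ← tabulate (2 ^ q) fun k => B.read (2 ^ j - 2 ^ q + k)
  let r ← sqrtConst (2 ^ (J - j - 1))
  let b₀ ← tabulate (2 ^ q) fun p => do
    times r (← query (2 ^ (J - (q + 1)) * (2 * p + 1) + 2 ^ (J - j - 1)))
  let b₁ ← tabulate (2 ^ q) fun p => do
    times r (← query (2 ^ (J - (q + 1)) * (2 * p + 1) - 2 ^ (J - j - 1)))
  let d ← tabulate (2 ^ q) fun p => minus (b₀ p.rev) (b₁ p.rev)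
  let y ← fastDCT4 q d
  let f ← sqrtConst (2 ^ (j - (q + 1)))
  let zero ← natConst 0
  let two ← natConst 2
  let y' ← tabulate (2 ^ q) fun l => do
    let t ← times f (← quot (y l) (← cosine (2 * l + 1) (4 * 2 ^ j)))
    if (2 ^ (j - (q + 1)) + (l : ℕ)) % 2 = 0 then return t else minus zero t
  let z₀ ← tabulate (2 ^ q) fun k => do
    let t ← quot (← plus (y' k.rev) (z k)) two
    if (← isLess ε (← absolute t)) then return t else return zero
  let z₁ ← tabulate (2 ^ q) fun k => minus (z k.rev) (z₀ k.rev)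
  let w ← tabulate (2 ^ q + 2 ^ q) fun k => return Fin.append z₀ z₁ k
  findSupport (2 ^ j - 2 ^ q) (2 ^ q + 2 ^ q) w ε

/-- The starting level `L = ⌈log₂ M⌉ + 1`, replaced by `J` if it exceeds `J`. -/
def startLevel (J M : ℕ) : ℕ := min (Nat.clog 2 M + 1) J

/-- The sparse fast algorithm that recovers a vector `x` of length `2^J` with short support of
length at most `M` from samples of its DCT-II, with threshold `ε`. -/
def sparseDCT (J M : ℕ) (ε : R) : Prog R (Block R) := do
  let L := startLevel J M
  ticks (L + 1)
  let B ← initialStep J L ε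
  loop (J - L) (fun i (B : Block R) =>
    if B.start + M < 2 ^ (L + (i : ℕ)) then stepNoCollision J (L + i) B
    else stepCollision J (L + i) ε B) B

end SparseTransform

/-!
The correctness part rests on following the support of the reflected periodizations `x^(j)`, from
the full length down to the starting level. The support is an interval of length at most `m`. It is
folded onto itself only when it meets both halves of the index range; as `2^j ≥ m` throughout, this
happens at most once, and afterwards the support sits at one end of the index range, so that every
further folding step merely copies or reflects it. At the superposition the inner boundary entry of
the folded vector cannot cancel: it is an unpaired boundary entry of the support, except when the
support is symmetric about the middle, where `m` is even and the entry is `x_μ + x_ν ≠ 0`. Hence the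
first nonzero index of `x^(j)` bounds the position of the support of `x^(j+1)`
(`FoldedSupport.fold`, `exists_foldedSupport`).

Going up, the sampled entries of the transform of `x` are, up to scaling, entries of the transforms
of the `x^(j)` (`sqrt_mul_zeroExtend_dctII`). The starting vector is obtained by orthogonality of
the cosines (`cosThree_inversion`). For the step from `x^(j)` to `X = x^(j+1)`, the missing
information is the difference `w` of the first half and the reversed second half of `X`, whose
DCT-IV is given by the oddly indexed entries of the transform of `X`. Without collision
`w = ± x^(j)`, and the sign is visible at any nonzero odd frequency; among the first `r` of them,
with `r` the support length, there is a nonzero one by a Vandermonde argument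
(`eq_zero_of_odd_cos_sums`). With a possible collision, `w` is supported in the last `2^q`
positions, and differences of neighbouring odd entries at `2^q` equispaced frequencies form a DCT-IV
of length `2^q` of `w`, weighted by cosines (`collision_inversion`).

The cost bounds do not use correctness and hold for every threshold. Stored blocks never have more
than `2^(c+1)` entries, `c = ⌈log₂ m⌉`, so that a step without collision costs `O(m)`. A collision
step costs `O(m log m)`, but it is executed at most once: the block it returns stays at distance at
least `2^c ≥ m` from both ends of the index range, and this excludes further collision steps
(`mainLoop_cost`).
-/

/-! ### Semantics and cost of composed programs -/

namespace Prog

variable {α β σ : Type} (b : ℕ → ℝ)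

theorem eval_bind (p : Prog ℝ α) (f : α → Prog ℝ β) :
    (p >>= f).eval b = (f (p.eval b)).eval b := by
  change (andThen p f).eval b = _
  induction p with
  | ret a => rfl
  | tick k ih => simp only [andThen, eval, ih]
  | _ => rename_i ih; simp only [andThen, eval, ih]

theorem time_bind (p : Prog ℝ α) (f : α → Prog ℝ β) :
    (p >>= f).time b = p.time b + (f (p.eval b)).time b := by
  change (andThen p f).time b = _
  induction p with
  | ret a => simp [andThen, eval, time]
  | tick k ih => simp only [andThen, eval, time, ih]; ring
  | _ => rename_i ih; simp only [andThen, eval, time, ih]; try ring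

theorem samples_bind (p : Prog ℝ α) (f : α → Prog ℝ β) :
    (p >>= f).samples b = p.samples b + (f (p.eval b)).samples b := by
  change (andThen p f).samples b = _
  induction p with
  | ret a => simp [andThen, eval, samples]
  | tick k ih => simp only [andThen, eval, samples, ih]
  | _ => rename_i ih; simp only [andThen, eval, samples, ih]; try ring

@[simp] theorem eval_pure (a : α) : (pure a : Prog ℝ α).eval b = a := rfl
@[simp] theorem time_pure (a : α) : (pure a : Prog ℝ α).time b = 0 := rfl
@[simp] theorem samples_pure (a : α) : (pure a : Prog ℝ α).samples b = 0 := rfl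
@[simp] theorem eval_plus (x y : ℝ) : (plus x y).eval b = x + y := rfl
@[simp] theorem time_plus (x y : ℝ) : (plus x y).time b = 1 := rfl
@[simp] theorem samples_plus (x y : ℝ) : (plus x y).samples b = 0 := rfl
@[simp] theorem eval_minus (x y : ℝ) : (minus x y).eval b = x - y := rfl
@[simp] theorem time_minus (x y : ℝ) : (minus x y).time b = 1 := rfl
@[simp] theorem samples_minus (x y : ℝ) : (minus x y).samples b = 0 := rfl
@[simp] theorem eval_times (x y : ℝ) : (times x y).eval b = x * y := rfl
@[simp] theorem time_times (x y : ℝ) : (times x y).time b = 1 := rfl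
@[simp] theorem samples_times (x y : ℝ) : (times x y).samples b = 0 := rfl
@[simp] theorem eval_quot (x y : ℝ) : (quot x y).eval b = x / y := rfl
@[simp] theorem time_quot (x y : ℝ) : (quot x y).time b = 1 := rfl
@[simp] theorem samples_quot (x y : ℝ) : (quot x y).samples b = 0 := rfl
@[simp] theorem eval_natConst (n : ℕ) : (natConst n : Prog ℝ ℝ).eval b = n := rfl
@[simp] theorem time_natConst (n : ℕ) : (natConst n : Prog ℝ ℝ).time b = 1 := rfl
@[simp] theorem samples_natConst (n : ℕ) : (natConst n : Prog ℝ ℝ).samples b = 0 := rfl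
@[simp] theorem eval_sqrtConst (n : ℕ) : (sqrtConst n : Prog ℝ ℝ).eval b = √(n : ℝ) := rfl
@[simp] theorem time_sqrtConst (n : ℕ) : (sqrtConst n : Prog ℝ ℝ).time b = 2 := rfl
@[simp] theorem samples_sqrtConst (n : ℕ) : (sqrtConst n : Prog ℝ ℝ).samples b = 0 := rfl
@[simp] theorem eval_sqrt_ret (x : ℝ) : (Prog.sqrt x .ret : Prog ℝ ℝ).eval b = √x := rfl
@[simp] theorem time_sqrt_ret (x : ℝ) : (Prog.sqrt x .ret : Prog ℝ ℝ).time b = 1 := rfl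
@[simp] theorem samples_sqrt_ret (x : ℝ) : (Prog.sqrt x .ret : Prog ℝ ℝ).samples b = 0 := rfl
@[simp] theorem eval_cosine (p q : ℕ) :
    (cosine p q : Prog ℝ ℝ).eval b = Real.cos (p * Real.pi / q) := rfl
@[simp] theorem time_cosine (p q : ℕ) : (cosine p q : Prog ℝ ℝ).time b = 1 := rfl
@[simp] theorem samples_cosine (p q : ℕ) : (cosine p q : Prog ℝ ℝ).samples b = 0 := rfl
@[simp] theorem eval_query (i : ℕ) : (query i : Prog ℝ ℝ).eval b = b i := rfl
@[simp] theorem time_query (i : ℕ) : (query i : Prog ℝ ℝ).time b = 1 := rfl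
@[simp] theorem samples_query (i : ℕ) : (query i : Prog ℝ ℝ).samples b = 1 := rfl
@[simp] theorem eval_isLess (x y : ℝ) : (isLess x y).eval b = decide (x < y) := rfl
@[simp] theorem time_isLess (x y : ℝ) : (isLess x y).time b = 1 := rfl
@[simp] theorem samples_isLess (x y : ℝ) : (isLess x y).samples b = 0 := rfl

@[simp] theorem time_ticks (n : ℕ) : (ticks n : Prog ℝ Unit).time b = n := by
  induction n with
  | zero => rfl
  | succ n ih => simp [ticks, time, ih]

@[simp] theorem samples_ticks (n : ℕ) : (ticks n : Prog ℝ Unit).samples b = 0 := by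
  induction n with
  | zero => rfl
  | succ n ih => simp [ticks, samples, ih]

@[simp] theorem eval_absolute (x : ℝ) : (absolute x).eval b = |x| := by
  by_cases h : x < 0
  · simp [absolute, eval_bind, h, abs_of_neg]
  · simp [absolute, eval_bind, h, abs_of_nonneg (not_lt.1 h)]

theorem time_absolute_le (x : ℝ) : (absolute x).time b ≤ 3 := by
  by_cases h : x < 0 <;> simp [absolute, time_bind, h]

@[simp] theorem samples_absolute (x : ℝ) : (absolute x).samples b = 0 := by
  by_cases h : x < 0 <;> simp [absolute, samples_bind, h]

theorem eval_tabulate {n : ℕ} (entry : Fin n → Prog ℝ ℝ) :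
    (tabulate n entry).eval b = fun i => (entry i).eval b := by
  induction n with
  | zero => funext i; exact i.elim0
  | succ n ih =>
    simp only [tabulate, eval_bind, eval_pure, ih]
    funext i
    refine Fin.lastCases ?_ (fun i => ?_) i <;> simp

theorem time_tabulate_le {n c : ℕ} (entry : Fin n → Prog ℝ ℝ)
    (h : ∀ i, (entry i).time b ≤ c) : (tabulate n entry).time b ≤ n * (c + 1) := by
  induction n with
  | zero => simp [tabulate, time]
  | succ n ih =>
    have h1 := ih (fun i => entry i.castSucc) (fun i => h _)
    have h2 := h (Fin.last n)
    simp only [tabulate, time_bind, time_pure, time_ticks]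
    linarith

theorem samples_tabulate_le {n c : ℕ} (entry : Fin n → Prog ℝ ℝ)
    (h : ∀ i, (entry i).samples b ≤ c) : (tabulate n entry).samples b ≤ n * c := by
  induction n with
  | zero => simp [tabulate, samples]
  | succ n ih =>
    have h1 := ih (fun i => entry i.castSucc) (fun i => h _)
    have h2 := h (Fin.last n)
    simp only [tabulate, samples_bind, samples_pure, samples_ticks]
    linarith

theorem samples_tabulate_eq_zero {n : ℕ} (entry : Fin n → Prog ℝ ℝ)
    (h : ∀ i, (entry i).samples b = 0) : (tabulate n entry).samples b = 0 := by
  simpa using samples_tabulate_le b entry (c := 0) (fun i => (h i).le)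

/-- Induction over the passes of a loop, for a property of the number of passes, the loop state,
the time spent and the samples read so far. -/
theorem loop_induction (I : ℕ → σ → ℕ → ℕ → Prop) {n : ℕ} (body : Fin n → σ → Prog ℝ σ) (s : σ)
    (h0 : I 0 s 0 0)
    (hs : ∀ (i : Fin n) s t a, I i s t a → I (i + 1) ((body i s).eval b)
      (t + 1 + (body i s).time b) (a + (body i s).samples b)) :
    I n ((loop n body s).eval b) ((loop n body s).time b) ((loop n body s).samples b) := by
  induction n with
  | zero => exact h0
  | succ n ih =>
    have h1 := ih (fun i => body i.castSucc) (fun i => hs i.castSucc)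
    have h2 := hs (Fin.last n) _ _ _ h1
    simp only [loop, eval_bind, time_bind, samples_bind, time_ticks, samples_ticks]
    rw [← add_assoc, zero_add]
    exact h2

theorem loop_invariant (I : ℕ → σ → Prop) {n : ℕ} (body : Fin n → σ → Prog ℝ σ) (s : σ)
    (h0 : I 0 s) (hs : ∀ (i : Fin n) s, I i s → I (i + 1) ((body i s).eval b)) :
    I n ((loop n body s).eval b) :=
  loop_induction b (fun i s _ _ => I i s) body s h0 fun i s _ _ h => hs i s h

theorem loop_cost {n c d : ℕ} (body : Fin n → σ → Prog ℝ σ) (s : σ)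
    (ht : ∀ i s, (body i s).time b ≤ c) (ha : ∀ i s, (body i s).samples b ≤ d) :
    (loop n body s).time b ≤ n * (c + 1) ∧ (loop n body s).samples b ≤ n * d := by
  refine loop_induction b (fun i _ t a => t ≤ i * (c + 1) ∧ a ≤ i * d) body s (by simp) ?_
  rintro i s t a ⟨h1, h2⟩
  have := ht i s
  have := ha i s
  constructor <;> linarith

end Prog

/-! ### Trigonometric kernels -/

/-- The kernel `cos(k(2l+1)π/(2n))` of the unnormalized DCT-III of length `n`. -/
noncomputable def cosThree (n k l : ℕ) : ℝ := Real.cos (k * (2 * l + 1) * Real.pi / (2 * n))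

/-- The kernel `cos((2k+1)(2l+1)π/(4n))` of the unnormalized DCT-IV of length `n`. -/
noncomputable def cosFour (n k l : ℕ) : ℝ :=
  Real.cos ((2 * k + 1) * (2 * l + 1) * Real.pi / (4 * n))

theorem cosThree_even (n k l : ℕ) : cosThree (2 * n) (2 * k) l = cosThree n k l := by
  unfold cosThree
  congr 1
  push_cast
  rw [show (2 * (k : ℝ)) * (2 * l + 1) * Real.pi = 2 * (k * (2 * l + 1) * Real.pi) by ring,
    mul_div_mul_left _ _ two_ne_zero]

theorem cosThree_odd (n k l : ℕ) : cosThree (2 * n) (2 * k + 1) l = cosFour n k l := by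
  unfold cosThree cosFour
  push_cast
  congr 2
  ring

theorem cosThree_reflect {n l : ℕ} (k : ℕ) (hl : l < n) :
    cosThree n k (n - 1 - l) = (-1) ^ k * cosThree n k l := by
  have hn : (n : ℝ) ≠ 0 := by exact_mod_cast (by omega : n ≠ 0)
  have hc : ((n - 1 - l : ℕ) : ℝ) = n - 1 - l := by
    rw [Nat.cast_sub (by omega), Nat.cast_sub (by omega), Nat.cast_one]
  unfold cosThree
  rw [hc, ← Real.cos_nat_mul_pi_sub]
  congr 1
  field_simp
  ring

/-- Multiplying the odd cosines by `2 cos θ` turns sums of neighbours into the even cosines, which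
is the reduction of the DCT-IV to the DCT-III. -/
theorem sum_cosFour_of_add_eq {n l : ℕ} {w V : ℕ → ℝ} (hV : V n = 0)
    (h : ∀ i < n, V i + V (i + 1) = w i) :
    ∑ k ∈ Finset.range n, cosFour n k l * w k =
      2 * Real.cos ((2 * l + 1) * Real.pi / (4 * n)) *
        ∑ k ∈ Finset.range n, cosThree n k l * (if k = 0 then V k / 2 else V k) := by
  set θ : ℝ := (2 * l + 1) * Real.pi / (4 * n) with hθ
  have h4 : ∀ k : ℕ, cosFour n k l = Real.cos ((2 * k + 1) * θ) := by
    intro k; unfold cosFour; congr 1; rw [hθ]; ring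
  have h3 : ∀ k : ℕ, cosThree n k l = Real.cos (2 * k * θ) := by
    intro k
    unfold cosThree
    congr 1
    rw [hθ, show (4 * n : ℝ) = 2 * (2 * n) by ring, div_mul_eq_div_div]
    ring
  have key : ∀ j ≤ n, ∑ k ∈ Finset.range j, cosFour n k l * w k =
      2 * Real.cos θ * ∑ k ∈ Finset.range j, cosThree n k l * (if k = 0 then V k / 2 else V k)
        + (if j = 0 then V 0 * Real.cos θ else V j * Real.cos ((2 * j - 1) * θ))
        - (if j = 0 then V 0 * Real.cos θ else 0) := by
    intro j hj
    induction j with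
    | zero => simp
    | succ j ih =>
      rw [Finset.sum_range_succ, Finset.sum_range_succ, ih (by omega), ← h j (by omega), h4, h3]
      have e : Real.cos ((2 * j + 1) * θ) + Real.cos ((2 * j - 1) * θ) =
          2 * Real.cos θ * Real.cos (2 * j * θ) := by
        rw [show (2 * (j : ℝ) + 1) * θ = 2 * j * θ + θ by ring,
          show (2 * (j : ℝ) - 1) * θ = 2 * j * θ - θ by ring, Real.cos_add, Real.cos_sub]
        ring
      have e' : (2 * ((j + 1 : ℕ) : ℝ) - 1) * θ = (2 * j + 1) * θ := by push_cast; ring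
      rw [e']
      rcases Nat.eq_zero_or_pos j with rfl | hj0
      · simp; ring
      · simp only [hj0.ne', if_false, Nat.succ_ne_zero]
        linear_combination V j * e
  rw [key n le_rfl]
  rcases Nat.eq_zero_or_pos n with rfl | hn
  · simp
  · simp [hn.ne', hV]

theorem sum_range_two_mul (n : ℕ) (g : ℕ → ℝ) :
    ∑ k ∈ Finset.range (2 * n), g k =
      ∑ k ∈ Finset.range n, g (2 * k) + ∑ k ∈ Finset.range n, g (2 * k + 1) := by
  induction n with
  | zero => simp
  | succ n ih =>
    rw [show 2 * (n + 1) = 2 * n + 1 + 1 by ring, Finset.sum_range_succ, Finset.sum_range_succ, ih,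
      Finset.sum_range_succ, Finset.sum_range_succ]
    ring

/-! ### The fast transforms -/

open Prog

section FastTransformSemantics

variable (b : ℕ → ℝ)

theorem eval_backSubst (n : ℕ) (w : Fin n → ℝ) :
    ∃ V : ℕ → ℝ, V n = 0 ∧ (∀ i : Fin n, V i + V (i + 1) = w i) ∧
      (backSubst n w).eval b = (V 0, fun i : Fin n => V i) := by
  induction n with
  | zero =>
    refine ⟨fun _ => 0, rfl, fun i => i.elim0, ?_⟩
    simp only [backSubst, eval_bind, eval_pure, eval_natConst, Nat.cast_zero]
    congr 1
    funext i; exact i.elim0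
  | succ n ih =>
    obtain ⟨V, h0, h1, h2⟩ := ih (Fin.tail w)
    refine ⟨fun i => Nat.casesOn i (w 0 - V 0) V, h0, ?_, ?_⟩
    · intro i
      refine Fin.cases ?_ (fun i => ?_) i
      · simp
      · simpa [Fin.tail] using h1 i
    · simp only [backSubst, eval_bind, eval_pure, h2, eval_minus]
      congr 1
      funext i
      refine Fin.cases ?_ (fun i => ?_) i <;> simp

theorem time_backSubst (n : ℕ) (w : Fin n → ℝ) : (backSubst n w).time b = 2 * n + 1 := by
  induction n with
  | zero => simp [backSubst, time_bind]
  | succ n ih =>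
    simp only [backSubst, time_bind, ih, time_minus, time_ticks, time_pure]
    ring

theorem samples_backSubst (n : ℕ) (w : Fin n → ℝ) : (backSubst n w).samples b = 0 := by
  induction n with
  | zero => simp [backSubst, samples_bind]
  | succ n ih => simp [backSubst, samples_bind, ih]

/-- Inputs and outputs of the transforms are written as restrictions of functions on `ℕ`, which
keeps the index arithmetic of the recursion out of `Fin`. -/
theorem eval_rawFourFromThree (q : ℕ) (three : (Fin (2 ^ q) → ℝ) → Prog ℝ (Fin (2 ^ q) → ℝ))
    (h : ∀ g : ℕ → ℝ, (three fun i => g i).eval b =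
      fun l : Fin (2 ^ q) => ∑ k ∈ Finset.range (2 ^ q), cosThree (2 ^ q) k l * g k) (w : ℕ → ℝ) :
    (rawFourFromThree q three fun i => w i).eval b =
      fun l : Fin (2 ^ q) => ∑ k ∈ Finset.range (2 ^ q), cosFour (2 ^ q) k l * w k := by
  obtain ⟨V, h0, h1, h2⟩ := eval_backSubst b (2 ^ q) (fun i => w i)
  have hv : (fun i : Fin (2 ^ q) => (if (i : ℕ) = 0 then quot (V i) (2 : ℝ) else pure (V i)).eval b)
      = fun i : Fin (2 ^ q) => (fun i : ℕ => if i = 0 then V i / 2 else V i) i := by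
    funext i
    split_ifs <;> simp_all
  simp only [rawFourFromThree, eval_bind, h2, eval_natConst, eval_tabulate, Nat.cast_ofNat, hv,
    eval_times, eval_cosine]
  rw [h fun i => if i = 0 then V i / 2 else V i]
  funext l
  rw [sum_cosFour_of_add_eq h0 (fun i hi => h1 ⟨i, hi⟩)]
  push_cast
  rfl

theorem time_rawFourFromThree (q c : ℕ) (three : (Fin (2 ^ q) → ℝ) → Prog ℝ (Fin (2 ^ q) → ℝ))
    (h : ∀ v, (three v).time b ≤ c) (w : Fin (2 ^ q) → ℝ) :
    (rawFourFromThree q three w).time b ≤ c + 8 * 2 ^ q + 2 := by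
  have h1 := fun (v : Fin (2 ^ q) → ℝ) (y : ℝ) => time_tabulate_le b (c := 1)
    (fun i : Fin (2 ^ q) => if (i : ℕ) = 0 then quot (v i) y else pure (v i))
    (fun i => by split_ifs <;> simp)
  have h2 := fun (f : Fin (2 ^ q) → ℝ) (y : ℝ) => time_tabulate_le b (c := 3)
    (fun l : Fin (2 ^ q) => (do
      let t ← cosine (2 * l + 1) (4 * 2 ^ q)
      let s ← times y t
      times s (f l) : Prog ℝ ℝ)) (fun i => by simp [time_bind])
  simp only [rawFourFromThree, time_bind, time_backSubst, time_natConst]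
  refine (Nat.add_le_add_left (Nat.add_le_add_left (Nat.add_le_add (h1 _ _)
    (Nat.add_le_add (h _) (h2 _ _))) _) _).trans ?_
  omega

theorem samples_rawFourFromThree (q : ℕ) (three : (Fin (2 ^ q) → ℝ) → Prog ℝ (Fin (2 ^ q) → ℝ))
    (h : ∀ v, (three v).samples b = 0) (w : Fin (2 ^ q) → ℝ) :
    (rawFourFromThree q three w).samples b = 0 := by
  simp only [rawFourFromThree, samples_bind, samples_backSubst, samples_natConst, h]
  rw [samples_tabulate_eq_zero, samples_tabulate_eq_zero]
  · intro i; simp [samples_bind]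
  · intro i; split_ifs <;> simp

theorem eval_rawThree (q : ℕ) (g : ℕ → ℝ) :
    (rawThree q fun i => g i).eval b =
      fun l : Fin (2 ^ q) => ∑ k ∈ Finset.range (2 ^ q), cosThree (2 ^ q) k l * g k := by
  induction q generalizing g with
  | zero =>
    funext l
    simp [rawThree, cosThree]
  | succ q ih =>
    have h2 : 2 ^ (q + 1) = 2 * 2 ^ q := by ring
    simp only [rawThree, eval_bind, eval_tabulate, eval_pure, ih (fun i => g (2 * i)),
      eval_rawFourFromThree b q _ ih (fun i => g (2 * i + 1))]
    funext l
    simp only [h2, sum_range_two_mul, cosThree_even, cosThree_odd]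
    by_cases h : (l : ℕ) < 2 ^ q
    · simp [h]
    · have hl : (l : ℕ) < 2 * 2 ^ q := h2 ▸ l.2
      have r3 : ∀ k, cosThree (2 ^ q) k l = cosThree (2 ^ q) k (2 * 2 ^ q - 1 - l) := fun k => by
        have := cosThree_reflect (2 * k) hl
        rw [cosThree_even, cosThree_even, pow_mul] at this
        simpa using this.symm
      have r4 : ∀ k, cosFour (2 ^ q) k l = -cosFour (2 ^ q) k (2 * 2 ^ q - 1 - l) := fun k => by
        have := cosThree_reflect (2 * k + 1) hl
        rw [cosThree_odd, cosThree_odd, (odd_two_mul_add_one k).neg_one_pow] at this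
        rw [this]
        simp
      simp only [h, dif_neg, not_false_eq_true, eval_minus, r3, r4, neg_mul,
        Finset.sum_neg_distrib, ← sub_eq_add_neg]

theorem time_rawThree (q : ℕ) (v : Fin (2 ^ q) → ℝ) : (rawThree q v).time b ≤ 8 * q * 2 ^ q := by
  induction q with
  | zero => simp [rawThree]
  | succ q ih =>
    have h1 := fun g : Fin (2 ^ q) → ℝ => time_tabulate_le b (c := 0)
      (fun i => (pure (g i) : Prog ℝ ℝ)) (fun i => by simp)
    have h2 := fun g : Fin (2 ^ (q + 1)) → Prog ℝ ℝ => time_tabulate_le b (c := 1) g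
    have hq : 1 ≤ 2 ^ q := Nat.one_le_two_pow
    simp only [rawThree, time_bind]
    refine (Nat.add_le_add (h1 _) (Nat.add_le_add (h1 _) (Nat.add_le_add (ih _)
      (Nat.add_le_add (time_rawFourFromThree b q _ _ ih _) (h2 _ ?_))))).trans ?_
    · intro l
      split_ifs <;> simp
    · rw [pow_succ]
      nlinarith

theorem samples_rawThree (q : ℕ) (v : Fin (2 ^ q) → ℝ) : (rawThree q v).samples b = 0 := by
  induction q with
  | zero => simp [rawThree]
  | succ q ih =>
    simp only [rawThree, samples_bind, ih, samples_rawFourFromThree b q _ ih]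
    rw [samples_tabulate_eq_zero, samples_tabulate_eq_zero, samples_tabulate_eq_zero]
    · intro l; split_ifs <;> simp
    · simp
    · simp

theorem eval_fastDCT3 (q : ℕ) (g : ℕ → ℝ) :
    (fastDCT3 q fun i => g i).eval b = fun l : Fin (2 ^ q) => √(2 / 2 ^ q) *
      ∑ k ∈ Finset.range (2 ^ q), cosThree (2 ^ q) k l * (if k = 0 then g k / √2 else g k) := by
  have hv : (fun i : Fin (2 ^ q) => (if (i : ℕ) = 0 then quot (g i) √2 else pure (g i)).eval b)
      = fun i : Fin (2 ^ q) => (fun i : ℕ => if i = 0 then g i / √2 else g i) i := by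
    funext i
    split_ifs <;> simp_all
  simp only [fastDCT3, eval_bind, eval_natConst, eval_quot, eval_sqrt_ret, eval_sqrtConst,
    eval_tabulate, eval_times, Nat.cast_ofNat, hv, Nat.cast_pow]
  rw [eval_rawThree b q fun i => if i = 0 then g i / √2 else g i]

theorem time_fastDCT3 (q : ℕ) (v : Fin (2 ^ q) → ℝ) :
    (fastDCT3 q v).time b ≤ (8 * q + 10) * 2 ^ q := by
  have h1 := fun (v : Fin (2 ^ q) → ℝ) (y : ℝ) => time_tabulate_le b (c := 1)
    (fun i : Fin (2 ^ q) => if (i : ℕ) = 0 then quot (v i) y else pure (v i))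
    (fun i => by split_ifs <;> simp)
  have h2 := fun (f : Fin (2 ^ q) → ℝ) (y : ℝ) => time_tabulate_le b (c := 1)
    (fun l : Fin (2 ^ q) => times y (f l)) (fun i => by simp)
  have hq : 1 ≤ 2 ^ q := Nat.one_le_two_pow
  simp only [fastDCT3, time_bind, time_natConst, time_quot, time_sqrt_ret, time_sqrtConst]
  refine (Nat.add_le_add_left (Nat.add_le_add_left (Nat.add_le_add_left (Nat.add_le_add_left
    (Nat.add_le_add (h1 _ _) (Nat.add_le_add (time_rawThree b q _) (h2 _ _))) _) _) _) _).trans ?_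
  linarith

theorem samples_fastDCT3 (q : ℕ) (v : Fin (2 ^ q) → ℝ) : (fastDCT3 q v).samples b = 0 := by
  simp only [fastDCT3, samples_bind, samples_natConst, samples_quot, samples_sqrt_ret,
    samples_sqrtConst, samples_rawThree]
  rw [samples_tabulate_eq_zero, samples_tabulate_eq_zero]
  · simp
  · intro i; split_ifs <;> simp

theorem eval_fastDCT4 (q : ℕ) (g : ℕ → ℝ) :
    (fastDCT4 q fun i => g i).eval b = fun l : Fin (2 ^ q) => √(2 / 2 ^ q) *
      ∑ k ∈ Finset.range (2 ^ q), cosFour (2 ^ q) k l * g k := by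
  simp only [fastDCT4, eval_bind, eval_natConst, eval_quot, eval_sqrt_ret,
    eval_tabulate, eval_times, Nat.cast_ofNat, eval_rawFourFromThree b q _ (eval_rawThree b q),
    Nat.cast_pow]

theorem time_fastDCT4 (q : ℕ) (v : Fin (2 ^ q) → ℝ) :
    (fastDCT4 q v).time b ≤ (8 * q + 16) * 2 ^ q := by
  have h2 := fun (f : Fin (2 ^ q) → ℝ) (y : ℝ) => time_tabulate_le b (c := 1)
    (fun l : Fin (2 ^ q) => times y (f l)) (fun i => by simp)
  have hq : 1 ≤ 2 ^ q := Nat.one_le_two_pow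
  simp only [fastDCT4, time_bind, time_natConst, time_quot, time_sqrt_ret]
  refine (Nat.add_le_add_left (Nat.add_le_add_left (Nat.add_le_add_left
    (Nat.add_le_add (time_rawFourFromThree b q _ _ (time_rawThree b q) _) (h2 _ _)) _) _) _).trans ?_
  linarith

theorem samples_fastDCT4 (q : ℕ) (v : Fin (2 ^ q) → ℝ) : (fastDCT4 q v).samples b = 0 := by
  simp only [fastDCT4, samples_bind, samples_natConst, samples_quot, samples_sqrt_ret,
    samples_rawFourFromThree b q _ (samples_rawThree b q)]
  rw [samples_tabulate_eq_zero]
  simp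

end FastTransformSemantics

/-! ### Orthogonality of the cosine kernels -/

open Finset in
/-- The Dirichlet kernel. -/
theorem sum_half_cos_mul_sin (φ : ℝ) (n : ℕ) (hn : 1 ≤ n) :
    (∑ k ∈ range n, (if k = 0 then 1 / 2 else 1) * Real.cos (k * φ)) * (2 * Real.sin (φ / 2)) =
      Real.sin (n * φ - φ / 2) := by
  induction n, hn using Nat.le_induction with
  | base =>
    have : φ - φ / 2 = φ / 2 := by ring
    simp [this]
  | succ n hn ih =>
    have e : ((n + 1 : ℕ) : ℝ) * φ - φ / 2 = n * φ + φ / 2 := by push_cast; ring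
    rw [sum_range_succ, add_mul, ih, e, Real.sin_sub, Real.sin_add, if_neg (by omega)]
    ring

open Finset in
/-- The sum depends on the parity of `t` only, so that the two sums that come from a product of two
cosines cancel. -/
theorem sum_half_cos {n t : ℕ} (ht : 0 < t) (htn : t < 2 * n) :
    ∑ k ∈ range n, (if k = 0 then 1 / 2 else 1) * Real.cos (k * (t * Real.pi / n)) =
      -(-1) ^ t / 2 := by
  have hn : (0 : ℝ) < n := by exact_mod_cast (by omega : 0 < n)
  have htn' : (t : ℝ) < 2 * n := by exact_mod_cast htn
  have ht' : (0 : ℝ) < t := by exact_mod_cast ht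
  have hs : 0 < Real.sin (t * Real.pi / n / 2) := by
    apply Real.sin_pos_of_pos_of_lt_pi
    · positivity
    · rw [div_div, div_lt_iff₀ (by positivity)]
      nlinarith [Real.pi_pos]
  have h := sum_half_cos_mul_sin (t * Real.pi / n) n (by omega)
  rw [show (n : ℝ) * (t * Real.pi / n) = t * Real.pi by field_simp, Real.sin_nat_mul_pi_sub] at h
  refine mul_right_cancel₀ (b := 2 * Real.sin (t * Real.pi / n / 2)) (by positivity) ?_
  rw [h]
  ring

open Finset in
theorem sum_cosThree_mul_cosThree {n l l' : ℕ} (hl : l < n) (hl' : l' < n) :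
    ∑ k ∈ range n, (if k = 0 then 1 / 2 else 1) * (cosThree n k l * cosThree n k l') =
      if l = l' then (n : ℝ) / 2 else 0 := by
  wlog h : l' ≤ l generalizing l l'
  · rw [show (if l = l' then (n : ℝ) / 2 else 0) = if l' = l then (n : ℝ) / 2 else 0 by
      simp only [eq_comm], ← this hl' hl (by omega)]
    exact sum_congr rfl fun k _ => by ring
  obtain ⟨t, rfl⟩ := Nat.exists_eq_add_of_le h
  have hn : (n : ℝ) ≠ 0 := by exact_mod_cast (by omega : n ≠ 0)
  have hp : ∀ k : ℕ, cosThree n k (l' + t) * cosThree n k l' =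
      (Real.cos (k * ((2 * l' + t + 1 : ℕ) * Real.pi / n)) + Real.cos (k * (t * Real.pi / n))) / 2 := by
    intro k
    rw [show (k : ℝ) * ((2 * l' + t + 1 : ℕ) * Real.pi / n) =
        k * (2 * (l' + t : ℕ) + 1) * Real.pi / (2 * n) + k * (2 * l' + 1) * Real.pi / (2 * n) by
          push_cast; field_simp; ring,
      show (k : ℝ) * (t * Real.pi / n) =
        k * (2 * (l' + t : ℕ) + 1) * Real.pi / (2 * n) - k * (2 * l' + 1) * Real.pi / (2 * n) by
          push_cast; field_simp; ring, Real.cos_add, Real.cos_sub]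
    unfold cosThree
    ring
  have hsplit : ∑ k ∈ range n, (if k = 0 then 1 / 2 else 1) *
        (cosThree n k (l' + t) * cosThree n k l') =
      (∑ k ∈ range n, (if k = 0 then 1 / 2 else 1) *
        Real.cos (k * ((2 * l' + t + 1 : ℕ) * Real.pi / n)) +
      ∑ k ∈ range n, (if k = 0 then 1 / 2 else 1) * Real.cos (k * (t * Real.pi / n))) / 2 := by
    rw [← sum_add_distrib, sum_div]
    exact sum_congr rfl fun k _ => by rw [hp]; ring
  rw [hsplit, sum_half_cos (by omega) (by omega)]
  rcases Nat.eq_zero_or_pos t with rfl | ht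
  · have h0 : ∑ k ∈ range n, (if k = 0 then (1 : ℝ) / 2 else 1) = n - 1 / 2 := by
      obtain ⟨m, rfl⟩ : ∃ m, n = m + 1 := ⟨n - 1, by omega⟩
      rw [sum_range_succ']
      simp
      ring
    simp only [Nat.cast_zero, zero_mul, zero_div, mul_zero, Real.cos_zero, mul_one, h0, add_zero,
      if_true, (odd_two_mul_add_one l').neg_one_pow]
    ring
  · rw [sum_half_cos ht (by omega), if_neg (by omega)]
    simp only [pow_succ, pow_add, pow_mul]
    norm_num
    ring

open Finset in
theorem sum_cos_odd_mul_sin (φ : ℝ) (n : ℕ) :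
    (∑ k ∈ range n, Real.cos ((2 * k + 1) * φ)) * (2 * Real.sin φ) = Real.sin (2 * n * φ) := by
  induction n with
  | zero => simp
  | succ n ih =>
    rw [sum_range_succ, add_mul, ih,
      show 2 * ((n + 1 : ℕ) : ℝ) * φ = (2 * n + 1) * φ + φ by push_cast; ring,
      show 2 * (n : ℝ) * φ = (2 * n + 1) * φ - φ by ring, Real.sin_sub, Real.sin_add]
    ring

open Finset in
theorem sum_cos_odd {n t : ℕ} (ht : 0 < t) (htn : t < 2 * n) :
    ∑ k ∈ range n, Real.cos ((2 * k + 1) * (t * Real.pi / (2 * n))) = 0 := by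
  have hn : (0 : ℝ) < n := by exact_mod_cast (by omega : 0 < n)
  have htn' : (t : ℝ) < 2 * n := by exact_mod_cast htn
  have ht' : (0 : ℝ) < t := by exact_mod_cast ht
  have hs : 0 < Real.sin (t * Real.pi / (2 * n)) := by
    apply Real.sin_pos_of_pos_of_lt_pi
    · positivity
    · rw [div_lt_iff₀ (by positivity)]
      nlinarith [Real.pi_pos]
  have h := sum_cos_odd_mul_sin (t * Real.pi / (2 * n)) n
  rw [show 2 * (n : ℝ) * (t * Real.pi / (2 * n)) = t * Real.pi by field_simp,
    Real.sin_nat_mul_pi] at h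
  simpa [hs.ne'] using h

open Finset in
theorem sum_cosFour_mul_cosFour {n l l' : ℕ} (hl : l < n) (hl' : l' < n) :
    ∑ k ∈ range n, cosFour n k l * cosFour n k l' = if l = l' then (n : ℝ) / 2 else 0 := by
  wlog h : l' ≤ l generalizing l l'
  · rw [show (if l = l' then (n : ℝ) / 2 else 0) = if l' = l then (n : ℝ) / 2 else 0 by
      simp only [eq_comm], ← this hl' hl (by omega)]
    exact sum_congr rfl fun k _ => by ring
  obtain ⟨t, rfl⟩ := Nat.exists_eq_add_of_le h
  have hn : (n : ℝ) ≠ 0 := by exact_mod_cast (by omega : n ≠ 0)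
  have hp : ∀ k : ℕ, cosFour n k (l' + t) * cosFour n k l' =
      (Real.cos ((2 * k + 1) * ((2 * l' + t + 1 : ℕ) * Real.pi / (2 * n))) +
        Real.cos ((2 * k + 1) * (t * Real.pi / (2 * n)))) / 2 := by
    intro k
    rw [show (2 * (k : ℝ) + 1) * ((2 * l' + t + 1 : ℕ) * Real.pi / (2 * n)) =
        (2 * k + 1) * (2 * (l' + t : ℕ) + 1) * Real.pi / (4 * n) +
          (2 * k + 1) * (2 * l' + 1) * Real.pi / (4 * n) by
          push_cast; field_simp; ring,
      show (2 * (k : ℝ) + 1) * (t * Real.pi / (2 * n)) =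
        (2 * k + 1) * (2 * (l' + t : ℕ) + 1) * Real.pi / (4 * n) -
          (2 * k + 1) * (2 * l' + 1) * Real.pi / (4 * n) by
          push_cast; field_simp; ring, Real.cos_add, Real.cos_sub]
    unfold cosFour
    ring
  simp only [hp]
  rw [← sum_div, sum_add_distrib, sum_cos_odd (by omega) (by omega)]
  rcases Nat.eq_zero_or_pos t with rfl | ht
  · simp
  · rw [sum_cos_odd ht (by omega), if_neg (by omega)]
    simp

open Finset in
/-- Inversion of the orthonormal DCT-II, up to the normalization of both sums. -/
theorem cosThree_inversion {n l : ℕ} (f : ℕ → ℝ) (hl : l < n) :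
    ∑ k ∈ range n, (if k = 0 then 1 / 2 else 1) * cosThree n k l *
      ∑ i ∈ range n, f i * cosThree n k i = n / 2 * f l := by
  have h : ∀ i ∈ range n, ∑ k ∈ range n, (if k = 0 then 1 / 2 else 1) * cosThree n k l *
      (f i * cosThree n k i) = f i * if l = i then (n : ℝ) / 2 else 0 := by
    intro i hi
    rw [← sum_cosThree_mul_cosThree hl (mem_range.1 hi), mul_sum]
    exact sum_congr rfl fun k _ => by ring
  simp only [mul_sum]
  rw [sum_comm, sum_congr rfl h]
  simp [hl, mul_comm]

open Finset in
theorem cosFour_inversion {n l : ℕ} (f : ℕ → ℝ) (hl : l < n) :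
    ∑ k ∈ range n, cosFour n k l * ∑ i ∈ range n, f i * cosFour n k i = n / 2 * f l := by
  have h : ∀ i ∈ range n, ∑ k ∈ range n, cosFour n k l * (f i * cosFour n k i) =
      f i * if l = i then (n : ℝ) / 2 else 0 := by
    intro i hi
    rw [← sum_cosFour_mul_cosFour hl (mem_range.1 hi), mul_sum]
    exact sum_congr rfl fun k _ => by ring
  simp only [mul_sum]
  rw [sum_comm, sum_congr rfl h]
  simp [hl, mul_comm]

/-! ### Cosine transforms of folded vectors -/

open Finset in
theorem sum_range_two_mul_reflect (n : ℕ) (g : ℕ → ℝ) :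
    ∑ l ∈ range (2 * n), g l = ∑ l ∈ range n, (g l + g (2 * n - 1 - l)) := by
  rw [two_mul, sum_range_add, sum_add_distrib, add_right_inj,
    ← sum_range_reflect (fun i => g (n + i))]
  refine sum_congr rfl fun l hl => ?_
  congr 1
  have := mem_range.1 hl
  omega

open Finset in
theorem sum_cosThree_even (X : ℕ → ℝ) (n k : ℕ) :
    ∑ l ∈ range (2 * n), X l * cosThree (2 * n) (2 * k) l =
      ∑ l ∈ range n, (X l + X (2 * n - 1 - l)) * cosThree n k l := by
  rw [sum_range_two_mul_reflect]
  refine sum_congr rfl fun l hl => ?_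
  have := mem_range.1 hl
  rw [cosThree_reflect _ (by omega), cosThree_even, pow_mul]
  ring

open Finset in
theorem sum_cosThree_odd (X : ℕ → ℝ) (n k : ℕ) :
    ∑ l ∈ range (2 * n), X l * cosThree (2 * n) (2 * k + 1) l =
      ∑ l ∈ range n, (X l - X (2 * n - 1 - l)) * cosFour n k l := by
  rw [sum_range_two_mul_reflect]
  refine sum_congr rfl fun l hl => ?_
  have := mem_range.1 hl
  rw [cosThree_reflect _ (by omega), cosThree_odd, pow_succ, pow_mul]
  ring

theorem zeroExtend_of_lt {n : ℕ} (x : Fin n → ℝ) {k : ℕ} (h : k < n) :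
    zeroExtend x k = x ⟨k, h⟩ := dif_pos h

open Finset in
theorem zeroExtend_dctII {n : ℕ} (x : Fin n → ℝ) {i : ℕ} (hi : i < n) :
    zeroExtend (dctII x) i =
      √(2 / n) * cosineWeight n i * ∑ l ∈ range n, zeroExtend x l * cosThree n i l := by
  rw [zeroExtend_of_lt _ hi, dctII, Matrix.mulVec, dotProduct, ← Fin.sum_univ_eq_sum_range
    (fun l => zeroExtend x l * cosThree n i l), mul_sum]
  refine sum_congr rfl fun l _ => ?_
  rw [zeroExtend_of_lt _ l.2, cosineMatrixII, Matrix.of_apply, cosThree]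
  ring

open Finset in
/-- The cosine sums of a reflected periodization are the cosine sums of the vector at the
frequencies that are multiples of `2^d`. -/
theorem sum_reflectedPeriodization {J d : ℕ} (x : Fin (2 ^ J) → ℝ) (hd : d ≤ J) (k : ℕ) :
    ∑ l ∈ range (2 ^ (J - d)), reflectedPeriodization J x d l * cosThree (2 ^ (J - d)) k l =
      ∑ l ∈ range (2 ^ J), zeroExtend x l * cosThree (2 ^ J) (2 ^ d * k) l := by
  induction d generalizing k with
  | zero => simp [reflectedPeriodization]
  | succ d ih =>
    have h2 : 2 ^ (J - d) = 2 * 2 ^ (J - (d + 1)) := by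
      rw [← pow_succ']; congr 1; omega
    rw [show 2 ^ (d + 1) * k = 2 ^ d * (2 * k) by ring, ← ih (by omega), h2, sum_cosThree_even]
    refine sum_congr rfl fun l hl => ?_
    simp only [reflectedPeriodization, if_pos (mem_range.1 hl), h2]

/-- The transform of a vector at a multiple of `2^d` in terms of its reflected periodization. -/
theorem sqrt_mul_zeroExtend_dctII {J d k : ℕ} (x : Fin (2 ^ J) → ℝ) (hd : d ≤ J)
    (hk : k < 2 ^ (J - d)) :
    √((2 ^ d : ℕ) : ℝ) * zeroExtend (dctII x) (2 ^ d * k) =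
      √(2 / 2 ^ (J - d)) * (if k = 0 then 1 / √2 else 1) * ∑ l ∈ Finset.range (2 ^ (J - d)),
        reflectedPeriodization J x d l * cosThree (2 ^ (J - d)) k l := by
  have hJ : 2 ^ J = 2 ^ d * 2 ^ (J - d) := by rw [← pow_add]; congr 1; omega
  have hlt : 2 ^ d * k < 2 ^ J := by
    rw [hJ]; exact Nat.mul_lt_mul_of_pos_left hk (by positivity)
  have hw : cosineWeight (2 ^ J) (2 ^ d * k) = if k = 0 then 1 / √2 else 1 := by
    rw [cosineWeight, hJ]
    congr 1
    rw [Nat.mul_dvd_mul_iff_left (by positivity), eq_iff_iff]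
    exact ⟨fun h => Nat.eq_zero_of_dvd_of_lt h hk, fun h => h ▸ dvd_zero _⟩
  have hs : √((2 ^ d : ℕ) : ℝ) * √(2 / (2 ^ J : ℕ)) = √(2 / 2 ^ (J - d)) := by
    rw [← Real.sqrt_mul (by positivity), hJ]
    congr 1
    push_cast
    field_simp
  rw [zeroExtend_dctII x hlt, hw, sum_reflectedPeriodization x hd, ← hs]
  ring

/-! ### The first odd frequencies detect a short vector -/

open Finset in
/-- If the first `n` odd cosine sums over `n` distinct nodes vanish, then so do all coefficients:
the span of `cos((2i+1)θ)`, `i < n`, contains `cos θ · cos(2θ)^i`, and the nodes `cos(2θ)` are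
distinct, so that a Vandermonde matrix remains. -/
theorem eq_zero_of_odd_cos_sums {n : ℕ} (θ a : Fin n → ℝ) (hc : ∀ l, Real.cos (θ l) ≠ 0)
    (hinj : Function.Injective fun l => Real.cos (2 * θ l))
    (h : ∀ k < n, ∑ l, a l * Real.cos ((2 * k + 1) * θ l) = 0) : a = 0 := by
  have key : ∀ r i : ℕ, i + r < n →
      ∑ l, a l * Real.cos (2 * θ l) ^ r * Real.cos ((2 * i + 1) * θ l) = 0 := by
    intro r
    induction r with
    | zero => intro i hi; simpa using h i hi
    | succ r ih =>
      intro i hi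
      have e : ∀ l, a l * Real.cos (2 * θ l) ^ (r + 1) * Real.cos ((2 * i + 1) * θ l) =
          (a l * Real.cos (2 * θ l) ^ r * Real.cos ((2 * (i + 1 : ℕ) + 1) * θ l) +
          a l * Real.cos (2 * θ l) ^ r * Real.cos ((2 * (i - 1 : ℕ) + 1) * θ l)) / 2 := by
        intro l
        have e1 : Real.cos ((2 * (i + 1 : ℕ) + 1) * θ l) + Real.cos ((2 * (i - 1 : ℕ) + 1) * θ l) =
            2 * Real.cos (2 * θ l) * Real.cos ((2 * i + 1) * θ l) := by
          -- For `i = 0` the truncated `i - 1` is right, since `cos(-θ) = cos θ`.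
          have e2 : Real.cos ((2 * (i - 1 : ℕ) + 1) * θ l) =
              Real.cos ((2 * i + 1) * θ l - 2 * θ l) := by
            rcases Nat.eq_zero_or_pos i with rfl | hi
            · rw [← Real.cos_neg]; congr 1; push_cast; ring
            · congr 1; push_cast [Nat.cast_sub hi]; ring
          rw [e2, show (2 * ((i + 1 : ℕ) : ℝ) + 1) * θ l = (2 * i + 1) * θ l + 2 * θ l by
            push_cast; ring, Real.cos_add, Real.cos_sub]
          ring
        rw [pow_succ]
        linear_combination (-(a l * Real.cos (2 * θ l) ^ r) / 2) * e1
      rw [sum_congr rfl fun l _ => e l, ← sum_div, sum_add_distrib, ih _ (by omega),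
        ih _ (by omega)]
      simp
  have hv : (fun l => a l * Real.cos (θ l)) = 0 := by
    refine Matrix.eq_zero_of_forall_pow_sum_mul_pow_eq_zero hinj fun i => ?_
    rw [← key i 0 (by omega)]
    refine sum_congr rfl fun l _ => ?_
    simp
    ring
  funext l
  simpa [hc l] using congrFun hv l

open Finset in
/-- A vector supported in an interval of length `r` is zero if its first `r` DCT-IV coefficients
vanish. -/
theorem eq_zero_of_cosFour_sums {n s r : ℕ} (f : ℕ → ℝ) (hr : s + r ≤ n)
    (h : ∀ k < r, ∑ l ∈ range r, f (s + l) * cosFour n k (s + l) = 0) :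
    ∀ l < r, f (s + l) = 0 := by
  rcases Nat.eq_zero_or_pos r with rfl | hr0
  · intro l hl; omega
  have hn : (0 : ℝ) < n := by exact_mod_cast (by omega : 0 < n)
  have hlt : ∀ l : Fin r, (2 * ((s + l : ℕ) : ℝ) + 1) < 2 * n := fun l => by
    exact_mod_cast (by omega : 2 * (s + (l : ℕ)) + 1 < 2 * n)
  have hz := eq_zero_of_odd_cos_sums
    (fun l : Fin r => (2 * ((s + l : ℕ) : ℝ) + 1) * Real.pi / (4 * n)) (fun l => f (s + l)) ?_ ?_ ?_
  · intro l hl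
    exact congrFun hz ⟨l, hl⟩
  · intro l
    have := hlt l
    apply (Real.cos_pos_of_mem_Ioo ⟨_, _⟩).ne'
    · have : 0 < (2 * ((s + l : ℕ) : ℝ) + 1) * Real.pi / (4 * n) := by positivity
      linarith [Real.pi_pos]
    · rw [div_lt_iff₀ (by positivity)]
      nlinarith [Real.pi_pos]
  · intro l l' hll
    have hm : ∀ l : Fin r, 2 * ((2 * ((s + l : ℕ) : ℝ) + 1) * Real.pi / (4 * n)) ∈
        Set.Icc 0 Real.pi := fun l => by
      refine ⟨by positivity, ?_⟩
      rw [← mul_div_assoc, div_le_iff₀ (by positivity)]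
      nlinarith [Real.pi_pos, hlt l]
    have := Real.injOn_cos (hm l) (hm l') hll
    have hpi := Real.pi_pos.ne'
    field_simp at this
    have h2 : ((s + l : ℕ) : ℝ) = (s + l' : ℕ) := by linarith
    ext
    have := Nat.cast_injective h2
    omega
  · intro k hk
    rw [← h k hk, ← Fin.sum_univ_eq_sum_range (fun l => f (s + l) * cosFour n k (s + l))]
    refine sum_congr rfl fun l _ => ?_
    rw [cosFour]
    congr 2
    ring

/-! ### Recovering a vector supported at the end from few odd frequencies -/

/-- The difference of two neighbouring odd cosines at the frequencies used in the collision step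
is, up to sign, a cosine of a DCT-IV of shorter length, when frequency and position are counted
from the end. -/
theorem cosFour_sub_cosFour {n Q G p l : ℕ} (hn : n = 2 * G * Q) (hG : 1 ≤ G) (hp : p < Q)
    (hl : l < Q) :
    cosFour n (G * (2 * (Q - 1 - p) + 1)) (n - 1 - l) -
      cosFour n (G * (2 * (Q - 1 - p) + 1) - 1) (n - 1 - l) =
      2 * (-1) ^ (G + l) * Real.cos ((2 * l + 1) * Real.pi / (4 * n)) * cosFour Q p l := by
  set r := Q - 1 - p with hr
  have hQn : Q ≤ n := by rw [hn]; nlinarith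
  have hQ0 : (Q : ℝ) ≠ 0 := by exact_mod_cast (by omega : Q ≠ 0)
  have hn0 : (n : ℝ) ≠ 0 := by exact_mod_cast (by omega : n ≠ 0)
  have hG0 : (G : ℝ) ≠ 0 := by exact_mod_cast (by omega : G ≠ 0)
  have hrc : (p : ℝ) = Q - 1 - r := by
    have : Q = p + 1 + r := by omega
    rw [this]; push_cast; ring
  have hlc : ((n - 1 - l : ℕ) : ℝ) = n - 1 - l := by
    rw [Nat.cast_sub (by omega), Nat.cast_sub (by omega), Nat.cast_one]
  have hGr : 1 ≤ G * (2 * r + 1) := Nat.mul_pos hG (by omega)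
  have hnc : (n : ℝ) = 2 * G * Q := by rw [hn]; push_cast; ring
  set ψ : ℝ := (2 * l + 1) * Real.pi / (4 * n) with hψ
  set β : ℝ := (2 * p + 1) * (2 * l + 1) * Real.pi / (4 * Q) with hβ
  set A : ℝ := β - Real.pi / 2 + (G * (2 * r + 1) : ℕ) * Real.pi - l * Real.pi with hA
  have hsin : Real.sin A = -((-1) ^ (G + l) * Real.cos β) := by
    rw [hA, Real.sin_sub_nat_mul_pi, Real.sin_add_nat_mul_pi, Real.sin_sub_pi_div_two,
      show G * (2 * r + 1) = 2 * (G * r) + G by ring, pow_add, pow_add, pow_mul]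
    simp
    ring
  have h1 : cosFour n (G * (2 * r + 1)) (n - 1 - l) = Real.cos (A + (Real.pi / 2 - ψ)) := by
    unfold cosFour
    congr 1
    rw [hA, hβ, hψ, hlc, hrc, hnc]
    push_cast
    field_simp
    ring
  have h2 : cosFour n (G * (2 * r + 1) - 1) (n - 1 - l) = Real.cos (A - (Real.pi / 2 - ψ)) := by
    unfold cosFour
    congr 1
    rw [hA, hβ, hψ, hlc, hrc, hnc, Nat.cast_sub hGr]
    push_cast
    field_simp
    ring
  rw [h1, h2, Real.cos_add A, Real.cos_sub A, hsin, Real.sin_pi_div_two_sub]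
  unfold cosFour
  rw [← hβ]
  ring

open Finset in
/-- Inversion formula of the collision step for a vector supported in the last `Q` of `n`
positions. -/
theorem collision_inversion {n Q G l : ℕ} (hn : n = 2 * G * Q) (hG : 1 ≤ G) (hl : l < Q)
    (w : ℕ → ℝ) (hw : ∀ i, i + Q < n → w i = 0) :
    ∑ p ∈ range Q, cosFour Q p l *
      (∑ i ∈ range n, w i * cosFour n (G * (2 * (Q - 1 - p) + 1)) i -
        ∑ i ∈ range n, w i * cosFour n (G * (2 * (Q - 1 - p) + 1) - 1) i) =
      Q * ((-1) ^ (G + l) * Real.cos ((2 * l + 1) * Real.pi / (4 * n)) * w (n - 1 - l)) := by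
  have hQn : Q ≤ n := by rw [hn]; nlinarith
  have hs : ∀ c : ℕ → ℝ, ∑ i ∈ range n, w i * c i =
      ∑ i ∈ range Q, w (n - 1 - i) * c (n - 1 - i) := by
    intro c
    rw [← sum_range_reflect (fun i => w i * c i)]
    symm
    refine sum_subset (range_mono hQn) fun i hi hi' => ?_
    rw [mem_range] at hi hi'
    rw [hw _ (by omega), zero_mul]
  have e : ∀ p ∈ range Q, cosFour Q p l *
      (∑ i ∈ range n, w i * cosFour n (G * (2 * (Q - 1 - p) + 1)) i -
        ∑ i ∈ range n, w i * cosFour n (G * (2 * (Q - 1 - p) + 1) - 1) i) =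
      2 * (cosFour Q p l * ∑ i ∈ range Q,
        ((-1) ^ (G + i) * Real.cos ((2 * i + 1) * Real.pi / (4 * n)) * w (n - 1 - i)) *
          cosFour Q p i) := by
    intro p hp
    rw [hs, hs, ← sum_sub_distrib, mul_left_comm, mul_sum (a := (2 : ℝ))]
    congr 1
    refine sum_congr rfl fun i hi => ?_
    rw [← mul_sub, cosFour_sub_cosFour hn hG (mem_range.1 hp) (mem_range.1 hi)]
    ring
  rw [sum_congr rfl e, ← mul_sum, cosFour_inversion
    (fun i => (-1) ^ (G + i) * Real.cos ((2 * i + 1) * Real.pi / (4 * n)) * w (n - 1 - i)) hl]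
  ring

/-! ### Supports of reflected periodizations -/

/-- The shapes that the support of a reflected periodization of a vector with short support of
length `m` can have: an interval `[a, b]` on which the vector is the original one, up to reversal,
or, once the two halves have been superposed, an interval at one end of the index range whose
inner boundary entry is nonzero. -/
structure FoldedSupport (n m : ℕ) (X : ℕ → ℝ) (a b : ℕ) : Prop where
  le : a ≤ b
  lt : b < n
  length_le : b + 1 ≤ a + m
  zero_outside : ∀ k, k < a ∨ b < k → X k = 0
  shape : (X a ≠ 0 ∧ X b ≠ 0 ∧ b + 1 = a + m ∧ (Even m → X a + X b ≠ 0)) ∨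
    (a = 0 ∧ X b ≠ 0) ∨ (b + 1 = n ∧ X a ≠ 0)

theorem FoldedSupport.exists_ne_zero {n m a b : ℕ} {X : ℕ → ℝ} (h : FoldedSupport n m X a b) :
    ∃ k, X k ≠ 0 := by
  rcases h.shape with ⟨h, -⟩ | ⟨-, h⟩ | ⟨-, h⟩ <;> exact ⟨_, h⟩

/-- One folding step. The shape of the support persists; nothing cancels at the inner boundary, so
that both halves vanish before the first nonzero index of the folded vector; and superposition can
only occur if that index is within `m` of the end. -/
theorem FoldedSupport.fold {n m a b : ℕ} {X f : ℕ → ℝ} (h : FoldedSupport (2 * n) m X a b)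
    (hm : m ≤ n) (hf : ∀ k, f k = if k < n then X k + X (2 * n - 1 - k) else 0) :
    (∃ a' b', FoldedSupport n m f a' b') ∧
    (∀ k < n, (∀ i ≤ k, f i = 0) → X k = 0 ∧ X (2 * n - 1 - k) = 0) ∧
    (∀ s, f s ≠ 0 → s + m < n → (∀ k, n ≤ k → X k = 0) ∨ (∀ k < n, X k = 0)) := by
  have hle := h.le
  have hlt := h.lt
  have hlen := h.length_le
  have h0 := h.zero_outside
  by_cases hb : b < n
  · -- The support lies in the left half.
    have hz : ∀ k, n ≤ k → X k = 0 := fun k hk => h0 k (Or.inr (by omega))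
    have hfX : ∀ k, f k = X k := fun k => by
      rw [hf]
      split_ifs with hk
      · rw [hz (2 * n - 1 - k) (by omega), add_zero]
      · rw [hz k (by omega)]
    obtain rfl : f = X := funext hfX
    refine ⟨⟨a, b, hle, hb, hlen, h0, ?_⟩, fun k hk hi => ⟨hi k le_rfl, hz _ (by omega)⟩,
      fun s _ _ => Or.inl hz⟩
    rcases h.shape with h | h | h
    · exact Or.inl h
    · exact Or.inr (Or.inl h)
    · omega
  by_cases ha : n ≤ a
  · -- The support lies in the right half.
    have hz : ∀ k < n, X k = 0 := fun k hk => h0 k (Or.inl (by omega))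
    have hfX : ∀ k < n, f k = X (2 * n - 1 - k) := fun k hk => by
      rw [hf, if_pos hk, hz k hk, zero_add]
    have ea : f (2 * n - 1 - a) = X a := by rw [hfX _ (by omega)]; congr 1; omega
    have eb : f (2 * n - 1 - b) = X b := by rw [hfX _ (by omega)]; congr 1; omega
    refine ⟨⟨2 * n - 1 - b, 2 * n - 1 - a, by omega, by omega, by omega, fun k hk => ?_, ?_⟩,
      fun k hk hi => ⟨hz k hk, ?_⟩, fun s _ _ => Or.inr hz⟩
    · by_cases hkn : k < n
      · rw [hfX k hkn]
        exact h0 _ (by omega)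
      · rw [hf, if_neg hkn]
    · rw [ea, eb]
      rcases h.shape with ⟨h1, h2, h3, h4⟩ | h | h
      · exact Or.inl ⟨h2, h1, by omega, fun hm => by rw [add_comm]; exact h4 hm⟩
      · omega
      · exact Or.inr (Or.inl ⟨by omega, h.2⟩)
    · rw [← hfX k hk]
      exact hi k le_rfl
  · -- The support meets both halves; only an original support can.
    push Not at hb ha
    have hA : X a ≠ 0 ∧ X b ≠ 0 ∧ b + 1 = a + m ∧ (Even m → X a + X b ≠ 0) := by
      rcases h.shape with h | h | h
      · exact h
      · omega
      · omega
    obtain ⟨hXa, hXb, hlen', hsum⟩ := hA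
    have hz : ∀ k < min a (2 * n - 1 - b), X k = 0 ∧ X (2 * n - 1 - k) = 0 := fun k hk =>
      ⟨h0 _ (by omega), h0 _ (by omega)⟩
    have hne : f (min a (2 * n - 1 - b)) ≠ 0 := by
      rw [hf, if_pos (by omega)]
      rcases lt_trichotomy a (2 * n - 1 - b) with hlt | heq | hgt
      · rw [min_eq_left hlt.le, h0 (2 * n - 1 - a) (by omega), add_zero]
        exact hXa
      · rw [min_eq_left heq.le, show 2 * n - 1 - a = b by omega]
        exact hsum ⟨n - a, by omega⟩
      · rw [min_eq_right hgt.le, h0 (2 * n - 1 - b) (by omega), zero_add,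
          show 2 * n - 1 - (2 * n - 1 - b) = b by omega]
        exact hXb
    have hfz : ∀ k < min a (2 * n - 1 - b), f k = 0 := fun k hk => by
      rw [hf, (hz k hk).1, (hz k hk).2]
      simp
    refine ⟨⟨min a (2 * n - 1 - b), n - 1, by omega, by omega, by omega, fun k hk => ?_,
      Or.inr (Or.inr ⟨by omega, hne⟩)⟩, fun k hk hi => hz k ?_, fun s hs hsm => ?_⟩
    · rcases hk with hk | hk
      · exact hfz k hk
      · rw [hf, if_neg (by omega)]
    · by_contra hk'
      exact hne (hi _ (by omega))
    · exact absurd (hfz s (by omega)) hs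

theorem reflectedPeriodization_succ {J d : ℕ} (x : Fin (2 ^ J) → ℝ) (hd : d < J) (k : ℕ) :
    reflectedPeriodization J x (d + 1) k =
      if k < 2 ^ (J - (d + 1)) then reflectedPeriodization J x d k +
        reflectedPeriodization J x d (2 * 2 ^ (J - (d + 1)) - 1 - k) else 0 := by
  rw [← pow_succ', show J - (d + 1) + 1 = J - d by omega]
  rfl

theorem le_two_pow_startLevel {J m : ℕ} (hm : m ≤ 2 ^ J) : m ≤ 2 ^ startLevel J m := by
  rw [startLevel]
  rcases min_choice (Nat.clog 2 m + 1) J with h | h <;> rw [h]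
  · exact (Nat.le_pow_clog one_lt_two m).trans (Nat.pow_le_pow_right two_pos (by omega))
  · exact hm

theorem exists_foldedSupport {J m : ℕ} {x : Fin (2 ^ J) → ℝ} {μ ν : Fin (2 ^ J)}
    (hx : IsShortSupport x m μ ν) (he : Even m → x μ + x ν ≠ 0) {d : ℕ}
    (hd : d ≤ J - startLevel J m) :
    ∃ a b, FoldedSupport (2 ^ (J - d)) m (reflectedPeriodization J x d) a b := by
  have hm : m ≤ 2 ^ J := by
    have := hx.length_eq
    have := ν.2
    omega
  induction d with
  | zero =>
    refine ⟨μ, ν, hx.le, ν.2, hx.length_eq.le, fun k hk => ?_, Or.inl ?_⟩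
    · simp only [reflectedPeriodization, zeroExtend]
      split_ifs with h
      · exact hx.zero_outside ⟨k, h⟩ hk
      · rfl
    · simp only [reflectedPeriodization, zeroExtend_of_lt x μ.2, zeroExtend_of_lt x ν.2]
      exact ⟨hx.first_ne, hx.last_ne, hx.length_eq, he⟩
  | succ d ih =>
    obtain ⟨a, b, h⟩ := ih (by omega)
    rw [show J - d = J - (d + 1) + 1 by omega, pow_succ'] at h
    refine (h.fold ?_ (reflectedPeriodization_succ x (by omega))).1
    exact (le_two_pow_startLevel hm).trans (Nat.pow_le_pow_right two_pos (by omega))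

/-! ### Finding the support -/

/-- The body of the loop in `findSupport`; the state holds the first and the last index found. -/
def supportPass {n : ℕ} (w : Fin n → ℝ) (ε : ℝ) (i : Fin n) (s : Option (ℕ × ℕ)) :
    Prog ℝ (Option (ℕ × ℕ)) := do
  if (← isLess ε (← absolute (w i))) then
    match s with
    | none => return some ((i : ℕ), (i : ℕ))
    | some (f, _) => return some (f, (i : ℕ))
  else return s

theorem findSupport_eq (offset : ℕ) {n : ℕ} (w : Fin n → ℝ) (ε : ℝ) :
    findSupport offset n w ε = loop n (supportPass w ε) none >>= fun found =>
      tabulate ((found.getD (0, 0)).2 + 1 - (found.getD (0, 0)).1) (fun i =>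
        if h : (found.getD (0, 0)).1 + (i : ℕ) < n then
          return w ⟨(found.getD (0, 0)).1 + i, h⟩ else natConst 0) >>= fun v =>
      pure ⟨offset + (found.getD (0, 0)).1,
        (found.getD (0, 0)).2 + 1 - (found.getD (0, 0)).1, v⟩ := rfl

/-- If no entry of the window exceeds the threshold, only the shape of the result is asserted; this
is all that the cost bounds need. -/
theorem eval_findSupport (b : ℕ → ℝ) (offset : ℕ) {n : ℕ} (w : Fin n → ℝ) (ε : ℝ) (hn : 1 ≤ n) :
    ∃ f l : ℕ, f ≤ l ∧ l < n ∧
      (findSupport offset n w ε).eval b = ⟨offset + f, l + 1 - f, fun i => zeroExtend w (f + i)⟩ ∧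
      ((∃ k, ε < |zeroExtend w k| ∧ k < n) → ε < |zeroExtend w f| ∧ ε < |zeroExtend w l| ∧
        ∀ k < n, k < f ∨ l < k → |zeroExtend w k| ≤ ε) := by
  have hloop := loop_invariant b (fun i (s : Option (ℕ × ℕ)) =>
      (s = none ∧ ∀ k < i, |zeroExtend w k| ≤ ε) ∨
      ∃ f l, s = some (f, l) ∧ f ≤ l ∧ l < i ∧ ε < |zeroExtend w f| ∧ ε < |zeroExtend w l| ∧
        ∀ k < i, k < f ∨ l < k → |zeroExtend w k| ≤ ε) (supportPass w ε) none (Or.inl ⟨rfl, by simp⟩) (by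
    intro i s hs
    have hw := zeroExtend_of_lt w i.2
    by_cases h : ε < |w i|
    · right
      rcases hs with ⟨rfl, hs⟩ | ⟨f, l, rfl, hfl, hl, hf, hl', hs⟩
      · refine ⟨i, i, by simp [supportPass, eval_bind, h], le_rfl, by omega, by rwa [hw], by rwa [hw],
          fun k hk hk' => hs k (by omega)⟩
      · exact ⟨f, i, by simp [supportPass, eval_bind, h], by omega, by omega, hf, by rwa [hw],
          fun k hk hk' => hs k (by omega) (by omega)⟩
    · have he : (supportPass w ε i s).eval b = s := by simp [supportPass, eval_bind, h]
      have hstep : ∀ k < (i : ℕ) + 1, (k < i → |zeroExtend w k| ≤ ε) → |zeroExtend w k| ≤ ε := by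
        intro k hk hk'
        rcases Nat.lt_succ_iff_lt_or_eq.1 hk with h1 | rfl
        · exact hk' h1
        · rw [hw]; exact not_lt.1 h
      rw [he]
      rcases hs with ⟨rfl, hs⟩ | ⟨f, l, rfl, hfl, hl, hf, hl', hs⟩
      · exact Or.inl ⟨rfl, fun k hk => hstep k hk (hs k)⟩
      · exact Or.inr ⟨f, l, rfl, hfl, by omega, hf, hl', fun k hk hk' =>
          hstep k hk fun h1 => hs k h1 hk'⟩)
  have hval : ∀ f l : ℕ, (fun i : Fin (l + 1 - f) => (if h : f + (i : ℕ) < n then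
      (pure (w ⟨f + i, h⟩) : Prog ℝ ℝ) else natConst 0).eval b) =
      fun i : Fin (l + 1 - f) => zeroExtend w (f + i) := by
    intro f l
    funext i
    rw [zeroExtend]
    split_ifs <;> simp
  simp only [findSupport_eq, eval_bind, eval_pure, eval_tabulate, hval]
  rcases hloop with ⟨hs, h⟩ | ⟨f, l, hs, h⟩
  · refine ⟨0, 0, le_rfl, hn, ?_, ?_⟩
    · rw [hs]; rfl
    · rintro ⟨k, hk, hk'⟩
      exact absurd hk (not_lt.2 (h k hk'))
  · obtain ⟨h1, h2, h3, h4, h5⟩ := h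
    refine ⟨f, l, h1, h2, ?_, fun _ => ⟨h3, h4, h5⟩⟩
    rw [hs]; rfl

theorem time_findSupport (b : ℕ → ℝ) (offset : ℕ) {n : ℕ} (w : Fin n → ℝ) (ε : ℝ) (hn : 1 ≤ n) :
    (findSupport offset n w ε).time b ≤ 7 * n ∧ (findSupport offset n w ε).samples b = 0 := by
  obtain ⟨f, l, hfl, hl, he, -⟩ := eval_findSupport b offset w ε hn
  have hb : ∀ i s, (supportPass w ε i s).time b ≤ 4 ∧ (supportPass w ε i s).samples b = 0 := by
    intro i s
    have := time_absolute_le b (w i)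
    by_cases h : ε < |w i| <;> rcases s with _ | ⟨f, l⟩ <;>
      simp [supportPass, time_bind, samples_bind, h] <;> omega
  have hcost := loop_cost b (supportPass w ε) none (fun i s => (hb i s).1) (fun i s => (hb i s).2.le)
  have hlen : ((findSupport offset n w ε).eval b).len ≤ n := by rw [he]; dsimp only; omega
  simp only [findSupport_eq, eval_bind, eval_pure] at hlen
  constructor
  · simp only [findSupport_eq, time_bind, time_pure]
    refine (Nat.add_le_add hcost.1 (Nat.add_le_add_right (time_tabulate_le b (c := 1) _ ?_) 0)).trans
      ?_
    · intro i
      split_ifs <;> simp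
    · have := Nat.mul_le_mul_right (1 + 1) hlen
      linarith
  · simp only [findSupport_eq, samples_bind, samples_pure]
    rw [samples_tabulate_eq_zero]
    · simpa using hcost.2
    · intro i
      split_ifs <;> simp

/-! ### Correctness of the steps -/

/-- The block `B` holds the vector `f` of length `2^j` on the interval between its first and its
last nonzero entry. -/
structure Represents (j : ℕ) (B : Block ℝ) (f : ℕ → ℝ) : Prop where
  len_pos : 1 ≤ B.len
  le : B.start + B.len ≤ 2 ^ j
  entry : ∀ k, B.entry k = f k
  first_ne : f B.start ≠ 0
  last_ne : f (B.start + B.len - 1) ≠ 0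

theorem Represents.val {j : ℕ} {B : Block ℝ} {f : ℕ → ℝ} (h : Represents j B f) (i : Fin B.len) :
    B.val i = f (B.start + i) := by
  rw [← h.entry, Block.entry, dif_pos (by omega)]
  congr 1
  ext
  simp

theorem Represents.eq_zero {j : ℕ} {B : Block ℝ} {f : ℕ → ℝ} (h : Represents j B f) {k : ℕ}
    (hk : k < B.start ∨ B.start + B.len ≤ k) : f k = 0 := by
  rw [← h.entry, Block.entry, dif_neg (by omega)]

/-- Finding the support of a window that holds a vector with entries that are zero or above the
threshold. -/
theorem represents_findSupport (b : ℕ → ℝ) {j offset n : ℕ} (w : Fin n → ℝ) {ε : ℝ} (hε : 0 ≤ ε)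
    (hn : offset + n ≤ 2 ^ j) {f : ℕ → ℝ} (hw : ∀ i : Fin n, w i = f (offset + i))
    (h0 : ∀ k, k < offset ∨ offset + n ≤ k → f k = 0) (hne : ∃ k, f k ≠ 0)
    (hf : ∀ k, f k ≠ 0 → ε < |f k|) :
    Represents j ((findSupport offset n w ε).eval b) f := by
  have hz : ∀ k < n, zeroExtend w k = f (offset + k) := fun k hk => by
    rw [zeroExtend_of_lt w hk, hw]
  obtain ⟨k, hk⟩ := hne
  have hko : offset ≤ k := by by_contra h; exact hk (h0 k (by omega))
  have hkn : k < offset + n := by by_contra h; exact hk (h0 k (by omega))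
  obtain ⟨a, l, hal, hl, he, h⟩ := eval_findSupport b offset w ε (by omega)
  obtain ⟨h1, h2, h3⟩ := h ⟨k - offset, by
    rw [hz _ (by omega), Nat.add_sub_cancel' hko]; exact hf k hk, by omega⟩
  rw [hz a (by omega)] at h1
  rw [hz l hl] at h2
  have hab : ∀ {y : ℝ}, ε < |y| → y ≠ 0 := fun h => abs_pos.1 (hε.trans_lt h)
  rw [he]
  refine ⟨by dsimp only; omega, by dsimp only; omega, fun k => ?_, hab h1, ?_⟩
  · unfold Block.entry
    dsimp only
    split_ifs with hk
    · rw [show a + (k - (offset + a)) = k - offset by omega, hz _ (by omega)]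
      congr 1
      omega
    · by_contra hk0
      have hk0 := Ne.symm hk0
      have hko : offset ≤ k := by by_contra h; exact hk0 (h0 k (by omega))
      have hkn : k < offset + n := by by_contra h; exact hk0 (h0 k (by omega))
      have := h3 (k - offset) (by omega) (by omega)
      rw [hz _ (by omega), Nat.add_sub_cancel' hko] at this
      exact absurd (hf k hk0) (not_lt.2 this)
  · dsimp only
    rw [show offset + a + (l + 1 - a) - 1 = offset + l by omega]
    exact hab h2

theorem represents_initialStep {J L : ℕ} (x : Fin (2 ^ J) → ℝ) {ε : ℝ} (hε : 0 ≤ ε) (hL : L ≤ J)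
    (h0 : ∀ k, 2 ^ L ≤ k → reflectedPeriodization J x (J - L) k = 0)
    (hne : ∃ k, reflectedPeriodization J x (J - L) k ≠ 0)
    (hf : ∀ k, reflectedPeriodization J x (J - L) k ≠ 0 →
      ε < |reflectedPeriodization J x (J - L) k|) :
    Represents L ((initialStep J L ε).eval (zeroExtend (dctII x)))
      (reflectedPeriodization J x (J - L)) := by
  set f := reflectedPeriodization J x (J - L) with hfdef
  have hJL : J - (J - L) = L := by omega
  set a : ℕ → ℝ := fun k => √((2 ^ (J - L) : ℕ) : ℝ) * zeroExtend (dctII x) (2 ^ (J - L) * k)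
    with ha
  have hy : ∀ l < 2 ^ L, √(2 / 2 ^ L) * ∑ k ∈ Finset.range (2 ^ L),
      cosThree (2 ^ L) k l * (if k = 0 then a k / √2 else a k) = f l := by
    intro l hl
    have e : ∀ k ∈ Finset.range (2 ^ L), cosThree (2 ^ L) k l * (if k = 0 then a k / √2 else a k) =
        √(2 / 2 ^ L) * ((if k = 0 then 1 / 2 else 1) * cosThree (2 ^ L) k l *
          ∑ i ∈ Finset.range (2 ^ L), f i * cosThree (2 ^ L) k i) := by
      intro k hk
      have hak := sqrt_mul_zeroExtend_dctII x (d := J - L) (k := k) (by omega)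
        (by rw [hJL]; exact Finset.mem_range.1 hk)
      rw [hJL] at hak
      simp only [ha]
      rw [hak]
      split_ifs
      · have h2 : √2 * √2 = 2 := Real.mul_self_sqrt (by norm_num)
        have h2' : 1 / √2 / √2 = 1 / 2 := by rw [div_div, h2]
        linear_combination (√(2 / 2 ^ L) * cosThree (2 ^ L) k l *
          ∑ i ∈ Finset.range (2 ^ L), f i * cosThree (2 ^ L) k i) * h2'
      · ring
    rw [Finset.sum_congr rfl e, ← Finset.mul_sum, cosThree_inversion f hl, ← mul_assoc,
      Real.mul_self_sqrt (by positivity)]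
    push_cast
    field_simp
  simp only [initialStep, eval_bind, eval_sqrtConst, eval_tabulate, eval_query, eval_times]
  rw [eval_fastDCT3 _ L a]
  refine represents_findSupport _ _ hε (by simp) (fun i => ?_) (fun k hk => h0 k (by omega)) hne hf
  rw [hy i i.2, zero_add]

theorem Represents.sum_eq {j : ℕ} {B : Block ℝ} {f : ℕ → ℝ} (h : Represents j B f) (c : ℕ → ℝ) :
    ∑ l ∈ Finset.range (2 ^ j), f l * c l =
      ∑ l ∈ Finset.range B.len, f (B.start + l) * c (B.start + l) := by
  have hle := h.le
  rw [← Finset.sum_image (s := Finset.range B.len) (g := fun l => B.start + l)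
    (f := fun l => f l * c l) (fun a _ b _ hab => Nat.add_left_cancel hab)]
  symm
  refine Finset.sum_subset (fun k hk => ?_) fun k hk hk' => ?_
  · obtain ⟨l, hl, rfl⟩ := Finset.mem_image.1 hk
    have := Finset.mem_range.1 hl
    exact Finset.mem_range.2 (by omega)
  · rw [h.eq_zero, zero_mul]
    by_contra hc
    exact hk' (Finset.mem_image.2 ⟨k - B.start, Finset.mem_range.2 (by omega), by omega⟩)

/-- The body of the loop in `stepNoCollision` that selects a sample of largest modulus; the state
holds its index, its value and its modulus. -/
def peakPass (J j : ℕ) (r : ℝ) {n : ℕ} (k : Fin n) (s : ℕ × ℝ × ℝ) : Prog ℝ (ℕ × ℝ × ℝ) := do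
  let y ← times r (← query (2 ^ (J - j - 1) * (2 * k + 1)))
  let t ← absolute y
  if (← isLess s.2.2 t) then return ((k : ℕ), y, t) else return s

/-- The body of the loop in `stepNoCollision` that accumulates one odd cosine sum. -/
def cosineSumPass (j k₀ : ℕ) (B : Block ℝ) (l : Fin B.len) (s : ℝ) : Prog ℝ ℝ := do
  let c ← cosine ((2 * k₀ + 1) * (2 * (B.start + l) + 1)) (2 * 2 ^ (j + 1))
  plus s (← times c (B.val l))

theorem stepNoCollision_eq (J j : ℕ) (B : Block ℝ) :
    stepNoCollision J j B = natConst 0 >>= fun zero => sqrtConst (2 ^ (J - j - 1)) >>= fun r =>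
      loop B.len (peakPass J j r) (0, zero, zero) >>= fun s =>
      loop B.len (cosineSumPass j s.1 B) zero >>= fun sum =>
      sqrtConst (2 ^ j) >>= fun c => quot sum c >>= fun u =>
      minus u s.2.1 >>= fun e₀ => absolute e₀ >>= fun d₀ =>
      plus u s.2.1 >>= fun e₁ => absolute e₁ >>= fun d₁ =>
      isLess d₀ d₁ >>= fun t => if t then pure B else
        tabulate B.len (fun i => pure (B.val i.rev)) >>= fun v =>
        pure ⟨2 ^ (j + 1) - B.len - B.start, B.len, v⟩ := rfl

/-- If one of the samples is nonzero, then so is the selected one. -/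
theorem eval_peak (b : ℕ → ℝ) (J j : ℕ) (r : ℝ) (n : ℕ) {s : ℕ × ℝ × ℝ}
    (hs : s = (loop n (peakPass J j r) (0, 0, 0)).eval b)
    (h : ∃ k < n, r * b (2 ^ (J - j - 1) * (2 * k + 1)) ≠ 0) :
    s.1 < n ∧ s.2.1 = r * b (2 ^ (J - j - 1) * (2 * s.1 + 1)) ∧ s.2.1 ≠ 0 := by
  have hloop := loop_invariant b (fun i (s : ℕ × ℝ × ℝ) => s.2.2 = |s.2.1| ∧
      ((s.2.1 = 0 ∧ ∀ k < i, r * b (2 ^ (J - j - 1) * (2 * k + 1)) = 0) ∨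
        (s.1 < i ∧ s.2.1 = r * b (2 ^ (J - j - 1) * (2 * s.1 + 1)) ∧ s.2.1 ≠ 0)))
      (n := n) (peakPass J j r) (0, 0, 0) (by simp) (by
    rintro i s ⟨h1, h2⟩
    by_cases h : s.2.2 < |r * b (2 ^ (J - j - 1) * (2 * i + 1))|
    · have he : (peakPass J j r i s).eval b = ((i : ℕ), r * b (2 ^ (J - j - 1) * (2 * i + 1)),
          |r * b (2 ^ (J - j - 1) * (2 * i + 1))|) := by
        simp only [peakPass, eval_bind, eval_query, eval_times, eval_absolute, eval_isLess, h,
          decide_true, if_true, eval_pure]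
      rw [he]
      refine ⟨rfl, Or.inr ⟨Nat.lt_succ_self _, rfl, abs_pos.1 (lt_of_le_of_lt ?_ h)⟩⟩
      rw [h1]
      exact abs_nonneg _
    · have he : (peakPass J j r i s).eval b = s := by
        simp only [peakPass, eval_bind, eval_query, eval_times, eval_absolute, eval_isLess, h,
          decide_false, Bool.false_eq_true, if_false, eval_pure]
      rw [he]
      refine ⟨h1, ?_⟩
      rcases h2 with ⟨h2, h3⟩ | ⟨h2, h3⟩
      · refine Or.inl ⟨h2, fun k hk => ?_⟩
        rcases Nat.lt_succ_iff_lt_or_eq.1 hk with hk | rfl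
        · exact h3 k hk
        · rw [h1, h2, abs_zero, not_lt] at h
          exact abs_nonpos_iff.1 h
      · exact Or.inr ⟨by omega, h3⟩)
  rw [← hs] at hloop
  obtain ⟨k, hk, hne⟩ := h
  rcases hloop.2 with ⟨-, h⟩ | h
  · exact absurd (h k hk) hne
  · exact h

theorem eval_cosineSum (b : ℕ → ℝ) {j k₀ : ℕ} {B : Block ℝ} {f : ℕ → ℝ} (h : Represents j B f) :
    (loop B.len (cosineSumPass j k₀ B) 0).eval b =
      ∑ l ∈ Finset.range (2 ^ j), f l * cosFour (2 ^ j) k₀ l := by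
  rw [h.sum_eq]
  refine loop_invariant b (fun i s => s = ∑ l ∈ Finset.range i,
    f (B.start + l) * cosFour (2 ^ j) k₀ (B.start + l)) _ _ (by simp) ?_
  rintro i _ rfl
  rw [Finset.sum_range_succ, ← h.val i, cosFour]
  simp only [cosineSumPass, eval_bind, eval_cosine, eval_times, eval_plus]
  rw [mul_comm (Real.cos _)]
  congr 4 <;> · push_cast; ring

/-- The step without collision. Since one half of `X` vanishes, the odd entries of the transform of
`X` are those computed from the folded vector `f`, up to a common sign; this sign is read off from
a nonzero sample. -/
theorem represents_stepNoCollision {J j : ℕ} {b : ℕ → ℝ} {B : Block ℝ} {f X : ℕ → ℝ}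
    (h : Represents j B f) (hX : ∀ k, 2 * 2 ^ j ≤ k → X k = 0)
    (hf : ∀ k, f k = if k < 2 ^ j then X k + X (2 * 2 ^ j - 1 - k) else 0)
    (hb : ∀ k < 2 ^ j, √((2 ^ (J - j - 1) : ℕ) : ℝ) * b (2 ^ (J - j - 1) * (2 * k + 1)) =
      (∑ l ∈ Finset.range (2 ^ j), (X l - X (2 * 2 ^ j - 1 - l)) * cosFour (2 ^ j) k l) /
        √((2 ^ j : ℕ) : ℝ))
    (hhalf : (∀ k, 2 ^ j ≤ k → X k = 0) ∨ (∀ k < 2 ^ j, X k = 0)) :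
    Represents (j + 1) ((stepNoCollision J j B).eval b) X := by
  have hle := h.le
  have hlen := h.len_pos
  set N := 2 ^ j with hN
  have hN2 : 2 ^ (j + 1) = 2 * N := by rw [hN, pow_succ']
  set r := √((2 ^ (J - j - 1) : ℕ) : ℝ) with hr
  have hc : √(((N : ℕ)) : ℝ) ≠ 0 := by positivity
  -- The transform does not vanish at the sampled frequencies.
  have hex : ∀ σ : ℝ, σ ≠ 0 → (∀ k < N, r * b (2 ^ (J - j - 1) * (2 * k + 1)) =
      σ * ((∑ l ∈ Finset.range N, f l * cosFour N k l) / √(N : ℝ))) →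
      ∃ k < B.len, r * b (2 ^ (J - j - 1) * (2 * k + 1)) ≠ 0 := by
    intro σ hσ hbσ
    by_contra! hcon
    have hz := eq_zero_of_cosFour_sums f hle fun k hk => by
      have := hcon k hk
      rw [hbσ k (by omega), mul_eq_zero, or_iff_right hσ, div_eq_zero_iff, or_iff_left hc,
        h.sum_eq] at this
      exact this
    exact h.first_ne (by simpa using hz 0 (by omega))
  rw [stepNoCollision_eq]
  simp only [eval_bind, eval_natConst, eval_sqrtConst, Nat.cast_zero, ← hr, eval_cosineSum b h,
    eval_quot, eval_minus, eval_plus, eval_absolute]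
  set s := (loop B.len (peakPass J j r) (0, 0, 0)).eval b with hs
  rcases hhalf with hhalf | hhalf
  · have hfX : ∀ k, f k = X k := fun k => by
      rw [hf]
      split_ifs with hk
      · rw [hhalf (2 * N - 1 - k) (by omega), add_zero]
      · rw [hhalf k (by omega)]
    have hbf : ∀ k < N, r * b (2 ^ (J - j - 1) * (2 * k + 1)) =
        (∑ l ∈ Finset.range N, f l * cosFour N k l) / √(N : ℝ) := fun k hk => by
      rw [hb k hk]
      congr 1
      refine Finset.sum_congr rfl fun l hl => ?_
      have := Finset.mem_range.1 hl
      rw [hfX, hhalf (2 * N - 1 - l) (by omega), sub_zero]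
    obtain ⟨h1, h2, h3⟩ := eval_peak b J j r B.len hs
      (hex 1 one_ne_zero fun k hk => by rw [hbf k hk, one_mul])
    have ht : (isLess |s.2.1 - s.2.1| |s.2.1 + s.2.1|).eval b = true := by
      rw [eval_isLess, sub_self, abs_zero, decide_eq_true_iff, abs_pos, ← two_mul]
      exact mul_ne_zero two_ne_zero h3
    rw [← hbf s.1 (by omega), ← h2, if_pos ht, eval_pure]
    obtain rfl : f = X := funext hfX
    exact ⟨hlen, by omega, h.entry, h.first_ne, h.last_ne⟩
  · have hfX : ∀ k < N, f k = X (2 * N - 1 - k) := fun k hk => by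
      rw [hf, if_pos hk, hhalf k hk, zero_add]
    have hXf : ∀ k, N ≤ k → k < 2 * N → X k = f (2 * N - 1 - k) := fun k hk hk' => by
      rw [hfX _ (by omega)]; congr 1; omega
    have hbf : ∀ k < N, r * b (2 ^ (J - j - 1) * (2 * k + 1)) =
        -1 * ((∑ l ∈ Finset.range N, f l * cosFour N k l) / √(N : ℝ)) := fun k hk => by
      rw [hb k hk, ← mul_div_assoc, Finset.mul_sum]
      congr 1
      refine Finset.sum_congr rfl fun l hl => ?_
      have := Finset.mem_range.1 hl
      rw [hfX _ this, hhalf l this]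
      ring
    obtain ⟨h1, h2, h3⟩ := eval_peak b J j r B.len hs (hex (-1) (by norm_num) hbf)
    have hu : (∑ l ∈ Finset.range N, f l * cosFour N s.1 l) / √(N : ℝ) = -s.2.1 := by
      rw [h2, hbf s.1 (by omega)]
      ring
    have ht : ¬(isLess |-s.2.1 - s.2.1| |-s.2.1 + s.2.1|).eval b = true := by
      rw [eval_isLess, neg_add_cancel, abs_zero, decide_eq_true_iff, not_lt]
      exact abs_nonneg _
    rw [hu, if_neg ht]
    simp only [eval_bind, eval_tabulate, eval_pure]
    have hst : 2 ^ (j + 1) - B.len - B.start = 2 * N - B.len - B.start := by rw [hN2]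
    rw [hst]
    refine ⟨hlen, by dsimp only; omega, fun k => ?_, ?_, ?_⟩
    · unfold Block.entry
      dsimp only
      split_ifs with hk
      · rw [h.val, hXf k (by omega) (by omega), Fin.val_rev]
        congr 1
        dsimp only
        omega
      · by_cases hk1 : k < N
        · rw [hhalf k hk1]
        by_cases hk2 : k < 2 * N
        · rw [hXf k (by omega) hk2, h.eq_zero (by omega)]
        · rw [hX k (by omega)]
    · dsimp only
      rw [hXf _ (by omega) (by omega),
        show 2 * N - 1 - (2 * N - B.len - B.start) = B.start + B.len - 1 by omega]
      exact h.last_ne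
    · dsimp only
      rw [hXf _ (by omega) (by omega),
        show 2 * N - 1 - (2 * N - B.len - B.start + B.len - 1) = B.start by omega]
      exact h.first_ne

theorem eval_read (b : ℕ → ℝ) (B : Block ℝ) (k : ℕ) : (B.read k).eval b = B.entry k := by
  unfold Block.read Block.entry
  split_ifs <;> simp

/-- The entry of the rescaled DCT-IV in `stepCollision`. -/
def signedQuotient (j q : ℕ) (f zero : ℝ) (y : Fin (2 ^ q) → ℝ) (l : Fin (2 ^ q)) :
    Prog ℝ ℝ := do
  let t ← times f (← quot (y l) (← cosine (2 * l + 1) (4 * 2 ^ j)))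
  if (2 ^ (j - (q + 1)) + (l : ℕ)) % 2 = 0 then return t else minus zero t

/-- The thresholded entry of the first half in `stepCollision`. -/
def thresholdedEntry (ε zero two : ℝ) {n : ℕ} (y' z : Fin n → ℝ) (k : Fin n) : Prog ℝ ℝ := do
  let t ← quot (← plus (y' k.rev) (z k)) two
  if (← isLess ε (← absolute t)) then return t else return zero

/-- `stepCollision` with the exponent `q` of the window length as an argument. -/
def stepCollisionOf (J j q : ℕ) (ε : ℝ) (B : Block ℝ) : Prog ℝ (Block ℝ) :=
  ticks (q + 1) >>= fun _ =>
  tabulate (2 ^ q) (fun k => B.read (2 ^ j - 2 ^ q + k)) >>= fun z =>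
  sqrtConst (2 ^ (J - j - 1)) >>= fun r =>
  tabulate (2 ^ q) (fun p => query (2 ^ (J - (q + 1)) * (2 * p + 1) + 2 ^ (J - j - 1)) >>=
    fun s => times r s) >>= fun b₀ =>
  tabulate (2 ^ q) (fun p => query (2 ^ (J - (q + 1)) * (2 * p + 1) - 2 ^ (J - j - 1)) >>=
    fun s => times r s) >>= fun b₁ =>
  tabulate (2 ^ q) (fun p => minus (b₀ p.rev) (b₁ p.rev)) >>= fun d =>
  fastDCT4 q d >>= fun y =>
  sqrtConst (2 ^ (j - (q + 1))) >>= fun f =>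
  natConst 0 >>= fun zero =>
  natConst 2 >>= fun two =>
  tabulate (2 ^ q) (signedQuotient j q f zero y) >>= fun y' =>
  tabulate (2 ^ q) (thresholdedEntry ε zero two y' z) >>= fun z₀ =>
  tabulate (2 ^ q) (fun k => minus (z k.rev) (z₀ k.rev)) >>= fun z₁ =>
  tabulate (2 ^ q + 2 ^ q) (fun k => pure (Fin.append z₀ z₁ k)) >>= fun w =>
  findSupport (2 ^ j - 2 ^ q) (2 ^ q + 2 ^ q) w ε

theorem stepCollision_eq (J j : ℕ) (ε : ℝ) (B : Block ℝ) :
    stepCollision J j ε B = stepCollisionOf J j (Nat.clog 2 (2 ^ j - B.start)) ε B := rfl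

theorem eval_signedQuotient (b : ℕ → ℝ) (j q : ℕ) (f : ℝ) (y : Fin (2 ^ q) → ℝ)
    (l : Fin (2 ^ q)) : (signedQuotient j q f 0 y l).eval b = (-1) ^ (2 ^ (j - (q + 1)) + (l : ℕ)) *
      (f * (y l / Real.cos ((2 * l + 1) * Real.pi / (4 * 2 ^ j)))) := by
  simp only [signedQuotient, eval_bind, eval_cosine, eval_quot, eval_times]
  split_ifs with h
  · rw [(Nat.even_iff.2 h).neg_one_pow]
    simp
  · rw [(Nat.odd_iff.2 (by omega)).neg_one_pow]
    simp

theorem eval_thresholdedEntry (b : ℕ → ℝ) {ε X : ℝ} {n : ℕ} (y' z : Fin n → ℝ) (k : Fin n)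
    (hX : (y' k.rev + z k) / 2 = X) (h : X ≠ 0 → ε < |X|) :
    (thresholdedEntry ε 0 2 y' z k).eval b = X := by
  have he : (thresholdedEntry ε 0 2 y' z k).eval b = if ε < |X| then X else 0 := by
    simp only [thresholdedEntry, eval_bind, eval_plus, eval_quot, hX, eval_absolute]
    by_cases h : ε < |X| <;> simp [h]
  rw [he]
  split_ifs with hlt
  · rfl
  · by_contra hX0
    exact hlt (h (Ne.symm hX0))

/-- The step with a possible collision: the first half of `X` is `(f + w) / 2` and the reversed
second half is `(f - w) / 2`, where their difference `w` is recovered from the samples by the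
inversion formula of the collision step. The hypothesis `hq` makes the exponent `j - (q + 1)` of
the algorithm a true difference. -/
theorem represents_stepCollision {J j : ℕ} {b : ℕ → ℝ} {B : Block ℝ} {f X : ℕ → ℝ} {ε : ℝ}
    (hε : 0 ≤ ε) (hj : j < J) (h : Represents j B f) (hX : ∀ k, 2 * 2 ^ j ≤ k → X k = 0)
    (hf : ∀ k, f k = if k < 2 ^ j then X k + X (2 * 2 ^ j - 1 - k) else 0)
    (hb : ∀ k < 2 ^ j, √((2 ^ (J - j - 1) : ℕ) : ℝ) * b (2 ^ (J - j - 1) * (2 * k + 1)) =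
      (∑ l ∈ Finset.range (2 ^ j), (X l - X (2 * 2 ^ j - 1 - l)) * cosFour (2 ^ j) k l) /
        √((2 ^ j : ℕ) : ℝ))
    (hq : Nat.clog 2 (2 ^ j - B.start) + 1 ≤ j)
    (hzero : ∀ k < B.start, X k = 0 ∧ X (2 * 2 ^ j - 1 - k) = 0)
    (hne : ∃ k, X k ≠ 0) (hXε : ∀ k, X k ≠ 0 → ε < |X k|) :
    Represents (j + 1) ((stepCollision J j ε B).eval b) X := by
  have hle := h.le
  have hlen := h.len_pos
  obtain ⟨q, hqdef⟩ : ∃ q, q = Nat.clog 2 (2 ^ j - B.start) := ⟨_, rfl⟩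
  have hQs : 2 ^ j - B.start ≤ 2 ^ q := hqdef ▸ Nat.le_pow_clog one_lt_two _
  rw [← hqdef] at hq
  obtain ⟨g, rfl⟩ : ∃ g, j = q + 1 + g := ⟨j - (q + 1), by omega⟩
  have hg : q + 1 + g - (q + 1) = g := by omega
  rw [stepCollision_eq, ← hqdef, stepCollisionOf]
  set N := 2 ^ (q + 1 + g) with hN
  set Q := 2 ^ q with hQ
  set w : ℕ → ℝ := fun l => X l - X (2 * N - 1 - l) with hw
  set S : ℕ → ℝ := fun k => ∑ l ∈ Finset.range N, w l * cosFour N k l with hS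
  have hNQ : N = 2 * 2 ^ g * Q := by rw [hN, hQ]; ring
  have hg1 : 1 ≤ 2 ^ g := Nat.one_le_two_pow
  have hQ1 : 1 ≤ Q := Nat.one_le_two_pow
  have hQN : Q ≤ N := by rw [hNQ]; nlinarith
  have hG : ∀ p < Q, 2 ^ g * (2 * p + 1) < N := fun p hp => by
    rw [hNQ, show 2 * 2 ^ g * Q = 2 ^ g * (2 * Q) by ring]
    exact Nat.mul_lt_mul_of_pos_left (by omega) (by omega)
  have hG1 : ∀ p, 1 ≤ 2 ^ g * (2 * p + 1) := fun p => Nat.mul_pos hg1 (by omega)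
  have hJ : 2 ^ (J - (q + 1)) = 2 ^ (J - (q + 1 + g) - 1) * (2 * 2 ^ g) := by
    rw [← pow_succ', ← pow_add]; congr 1; omega
  have hfN : ∀ k < N, f k = X k + X (2 * N - 1 - k) := fun k hk => by rw [hf, if_pos hk]
  -- Each stage of the program computes the quantity of the inversion formula.
  have e_z : (tabulate Q fun k => B.read (N - Q + k)).eval b = fun k : Fin Q => f (N - Q + k) := by
    rw [eval_tabulate]
    funext k
    rw [eval_read, h.entry]
  set r := √((2 ^ (J - (q + 1 + g) - 1) : ℕ) : ℝ) with hr
  have e_b0 : (tabulate Q fun p => query (2 ^ (J - (q + 1)) * (2 * p + 1) +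
      2 ^ (J - (q + 1 + g) - 1)) >>= fun s => times r s).eval b =
      fun p : Fin Q => S (2 ^ g * (2 * p + 1)) / √(N : ℝ) := by
    rw [eval_tabulate]
    funext p
    rw [eval_bind, eval_query, eval_times, ← hb _ (hG p p.2)]
    congr 2
    rw [hJ]
    ring
  have e_b1 : (tabulate Q fun p => query (2 ^ (J - (q + 1)) * (2 * p + 1) -
      2 ^ (J - (q + 1 + g) - 1)) >>= fun s => times r s).eval b =
      fun p : Fin Q => S (2 ^ g * (2 * p + 1) - 1) / √(N : ℝ) := by
    rw [eval_tabulate]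
    funext p
    rw [eval_bind, eval_query, eval_times, ← hb _ (by have := hG p p.2; omega)]
    congr 2
    have := hG1 p
    obtain ⟨t, ht⟩ : ∃ t, 2 ^ g * (2 * (p : ℕ) + 1) = t + 1 := ⟨_, (Nat.sub_add_cancel this).symm⟩
    rw [hJ, show 2 ^ (J - (q + 1 + g) - 1) * (2 * 2 ^ g) * (2 * (p : ℕ) + 1) =
      2 ^ (J - (q + 1 + g) - 1) * (2 * (2 ^ g * (2 * p + 1))) by ring, ht]
    refine Nat.sub_eq_of_eq_add ?_
    rw [Nat.add_sub_cancel]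
    ring
  set d : ℕ → ℝ := fun p => (S (2 ^ g * (2 * (Q - 1 - p) + 1)) -
    S (2 ^ g * (2 * (Q - 1 - p) + 1) - 1)) / √(N : ℝ) with hd
  have e_d : (tabulate Q fun p : Fin Q => minus (S (2 ^ g * (2 * p.rev + 1)) / √(N : ℝ))
      (S (2 ^ g * (2 * p.rev + 1) - 1) / √(N : ℝ))).eval b = fun p : Fin Q => d p := by
    rw [eval_tabulate]
    funext p
    rw [eval_minus, Fin.val_rev, ← sub_div, show Q - ((p : ℕ) + 1) = Q - 1 - p by omega]
  have hw0 : ∀ i, i + Q < N → w i = 0 := fun i hi => by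
    have := hzero i (by omega)
    rw [hw]
    dsimp only
    rw [this.1, this.2, sub_zero]
  have e_y' : (tabulate Q (signedQuotient (q + 1 + g) q √((2 ^ g : ℕ) : ℝ) 0 fun l : Fin (2 ^ q) =>
      √(2 / 2 ^ q) * ∑ k ∈ Finset.range (2 ^ q), cosFour (2 ^ q) k l * d k)).eval b =
      fun l : Fin Q => w (N - 1 - l) := by
    rw [eval_tabulate]
    funext l
    have hcos : Real.cos ((2 * l + 1) * Real.pi / (4 * 2 ^ (q + 1 + g))) ≠ 0 := by
      have hl : 2 * ((l : ℕ) : ℝ) + 1 < 2 * 2 ^ (q + 1 + g) := by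
        have := l.2
        have : 2 * (l : ℕ) + 1 < 2 * 2 ^ (q + 1 + g) := by omega
        exact_mod_cast this
      apply (Real.cos_pos_of_mem_Ioo ⟨_, _⟩).ne'
      · have : 0 < (2 * ((l : ℕ) : ℝ) + 1) * Real.pi / (4 * 2 ^ (q + 1 + g)) := by positivity
        linarith [Real.pi_pos]
      · rw [div_lt_iff₀ (by positivity)]
        nlinarith [Real.pi_pos]
    have hsum := collision_inversion hNQ hg1 l.2 w hw0
    have hd' : ∑ k ∈ Finset.range (2 ^ q), cosFour (2 ^ q) k l * d k =
        (Q * ((-1) ^ (2 ^ g + (l : ℕ)) *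
          Real.cos ((2 * l + 1) * Real.pi / (4 * N)) * w (N - 1 - l))) / √(N : ℝ) := by
      rw [← hsum, Finset.sum_div]
      exact Finset.sum_congr rfl fun k _ => by rw [hd]; dsimp only; rw [mul_div_assoc]
    have hscale : √((2 ^ g : ℕ) : ℝ) * √(2 / 2 ^ q) * Q = √(N : ℝ) := by
      symm
      rw [Real.sqrt_eq_iff_mul_self_eq (by positivity) (by positivity)]
      symm
      calc √((2 ^ g : ℕ) : ℝ) * √(2 / 2 ^ q) * Q * (√((2 ^ g : ℕ) : ℝ) * √(2 / 2 ^ q) * Q)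
          = (√((2 ^ g : ℕ) : ℝ) * √((2 ^ g : ℕ) : ℝ)) * (√(2 / 2 ^ q) * √(2 / 2 ^ q)) *
            (Q * Q) := by ring
        _ = N := by
          rw [Real.mul_self_sqrt (by positivity), Real.mul_self_sqrt (by positivity), hNQ, hQ]
          push_cast
          field_simp
    have hNs : √(N : ℝ) ≠ 0 := by positivity
    have hsgn : ((-1 : ℝ) ^ (2 ^ g + (l : ℕ))) * (-1) ^ (2 ^ g + (l : ℕ)) = 1 := by
      rw [← mul_pow]; norm_num
    have hNc : ((N : ℕ) : ℝ) = 2 ^ (q + 1 + g) := by rw [hN]; push_cast; rfl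
    rw [eval_signedQuotient, hg, hd', hNc]
    rw [hNc] at hscale hNs
    set c := Real.cos ((2 * l + 1) * Real.pi / (4 * 2 ^ (q + 1 + g)))
    set σ : ℝ := (-1) ^ (2 ^ g + (l : ℕ))
    set ρ : ℝ := √(2 ^ (q + 1 + g))
    calc σ * (√((2 ^ g : ℕ) : ℝ) * (√(2 / 2 ^ q) * (Q * (σ * c * w (N - 1 - l)) / ρ) / c))
        = (σ * σ) * ((√((2 ^ g : ℕ) : ℝ) * √(2 / 2 ^ q) * Q) / ρ) * (c / c) * w (N - 1 - l) := by
          ring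
      _ = w (N - 1 - l) := by
          rw [hsgn, hscale, div_self hNs, div_self hcos]
          ring
  have e_z₀ : (tabulate Q (thresholdedEntry ε 0 2 (fun l : Fin Q => w (N - 1 - l))
      fun k : Fin Q => f (N - Q + k))).eval b = fun k : Fin Q => X (N - Q + k) := by
    rw [eval_tabulate]
    funext k
    refine eval_thresholdedEntry b _ _ k ?_ (hXε _)
    rw [Fin.val_rev, show N - 1 - (Q - ((k : ℕ) + 1)) = N - Q + k by omega, hfN _ (by omega)]
    simp only [hw]
    ring
  have e_z₁ : (tabulate Q fun k : Fin Q => minus (f (N - Q + k.rev)) (X (N - Q + k.rev))).eval b =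
      fun k : Fin Q => X (N + k) := by
    rw [eval_tabulate]
    funext k
    rw [eval_minus, Fin.val_rev, hfN _ (by omega), add_sub_cancel_left]
    congr 1
    omega
  rw [eval_bind, eval_bind, e_z, eval_bind, eval_sqrtConst, ← hr, eval_bind, e_b0, eval_bind, e_b1,
    eval_bind, e_d, eval_bind, eval_fastDCT4, eval_bind, eval_sqrtConst, hg, eval_bind,
    eval_natConst, eval_bind, eval_natConst, Nat.cast_zero, Nat.cast_ofNat, eval_bind, e_y',
    eval_bind, e_z₀, eval_bind, e_z₁, eval_bind, eval_tabulate]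
  refine represents_findSupport b _ hε (by rw [pow_succ]; omega) (fun i => ?_) (fun k hk => ?_)
    hne hXε
  · rw [eval_pure]
    refine Fin.addCases (fun i => ?_) (fun i => ?_) i
    · rw [Fin.append_left, Fin.val_castAdd]
    · rw [Fin.append_right, Fin.val_natAdd]
      congr 1
      omega
  · rcases hk with hk | hk
    · exact (hzero k (by omega)).1
    · by_cases hk2 : 2 * N ≤ k
      · exact hX k hk2
      · have := (hzero (2 * N - 1 - k) (by omega)).2
        rwa [show 2 * N - 1 - (2 * N - 1 - k) = k by omega] at this

/-! ### Cost of the steps -/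

theorem time_initialStep (b : ℕ → ℝ) (J L : ℕ) (ε : ℝ) :
    (initialStep J L ε).time b ≤ (8 * L + 22) * 2 ^ L := by
  have hL : 1 ≤ 2 ^ L := Nat.one_le_two_pow
  simp only [initialStep, time_bind, time_sqrtConst]
  refine (Nat.add_le_add_left (Nat.add_le_add (time_tabulate_le b (c := 2) _ fun k => ?_)
    (Nat.add_le_add (time_fastDCT3 b L _) (time_findSupport b 0 _ ε hL).1)) _).trans ?_
  · simp [time_bind]
  · linarith

theorem samples_initialStep (b : ℕ → ℝ) (J L : ℕ) (ε : ℝ) :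
    (initialStep J L ε).samples b ≤ 2 ^ L := by
  have hL : 1 ≤ 2 ^ L := Nat.one_le_two_pow
  simp only [initialStep, samples_bind, samples_sqrtConst, samples_fastDCT3,
    (time_findSupport b 0 _ ε hL).2]
  simpa using samples_tabulate_le b (n := 2 ^ L) (c := 1)
    (fun k => (do times (√((2 ^ (J - L) : ℕ) : ℝ)) (← query (2 ^ (J - L) * k)) : Prog ℝ ℝ))
    (fun k => by simp [samples_bind])

theorem eval_initialStep_bounds (b : ℕ → ℝ) (J L : ℕ) (ε : ℝ) :
    1 ≤ ((initialStep J L ε).eval b).len ∧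
      ((initialStep J L ε).eval b).start + ((initialStep J L ε).eval b).len ≤ 2 ^ L := by
  simp only [initialStep, eval_bind]
  obtain ⟨f, l, hfl, hl, he, -⟩ := eval_findSupport b 0 (ε := ε) (Nat.one_le_two_pow (n := L))
    (w := (fastDCT3 L ((tabulate (2 ^ L) fun k => query (2 ^ (J - L) * k) >>= fun s =>
      times ((sqrtConst (2 ^ (J - L)) : Prog ℝ ℝ).eval b) s).eval b)).eval b)
  rw [he]
  dsimp only
  omega

theorem stepNoCollision_cost (b : ℕ → ℝ) (J j : ℕ) (B : Block ℝ) (hB : 1 ≤ B.len) :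
    (stepNoCollision J j B).time b ≤ 27 * B.len ∧ (stepNoCollision J j B).samples b ≤ B.len := by
  have hp : ∀ (r : ℝ) (i : Fin B.len) s, (peakPass J j r i s).time b ≤ 6 ∧
      (peakPass J j r i s).samples b ≤ 1 := by
    intro r i s
    have := time_absolute_le b (r * b (2 ^ (J - j - 1) * (2 * i + 1)))
    simp only [peakPass, time_bind, samples_bind, eval_query, eval_times,
      time_query, time_times, samples_query, samples_times, samples_absolute, time_isLess,
      samples_isLess]
    split_ifs <;> simp <;> omega
  have hc : ∀ (k₀ : ℕ) (i : Fin B.len) s, (cosineSumPass j k₀ B i s).time b ≤ 3 ∧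
      (cosineSumPass j k₀ B i s).samples b ≤ 0 := by
    intro k₀ i s
    simp [cosineSumPass, time_bind, samples_bind]
  have h1 := fun r s => loop_cost b (n := B.len) (peakPass J j r) s (fun i s => (hp r i s).1)
    (fun i s => (hp r i s).2)
  have h2 := fun k₀ s => loop_cost b (n := B.len) (cosineSumPass j k₀ B) s
    (fun i s => (hc k₀ i s).1) (fun i s => (hc k₀ i s).2)
  have h3 := time_tabulate_le b (c := 0) (fun i : Fin B.len => (pure (B.val i.rev) : Prog ℝ ℝ))
    (fun i => by simp)
  have h4 := samples_tabulate_eq_zero b (fun i : Fin B.len => (pure (B.val i.rev) : Prog ℝ ℝ))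
    (fun i => by simp)
  rw [stepNoCollision_eq]
  simp only [time_bind, samples_bind, eval_natConst, eval_sqrtConst, eval_quot,
    eval_minus, eval_plus, eval_absolute, time_natConst, time_sqrtConst, time_quot, time_minus,
    time_plus, time_isLess, samples_natConst, samples_sqrtConst, samples_quot, samples_minus,
    samples_plus, samples_absolute, samples_isLess]
  set s := (loop B.len (peakPass J j √((2 ^ (J - j - 1) : ℕ) : ℝ)) (0, ((0 : ℕ) : ℝ),
    ((0 : ℕ) : ℝ))).eval b
  have h1 := h1 √((2 ^ (J - j - 1) : ℕ) : ℝ) (0, ((0 : ℕ) : ℝ), ((0 : ℕ) : ℝ))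
  have h2 := h2 s.1 ((0 : ℕ) : ℝ)
  set u := (loop B.len (cosineSumPass j s.1 B) ((0 : ℕ) : ℝ)).eval b / √((2 ^ j : ℕ) : ℝ)
  have h5 := time_absolute_le b (u - s.2.1)
  have h6 := time_absolute_le b (u + s.2.1)
  constructor
  · split_ifs
    · simp only [time_pure]
      omega
    · simp only [time_bind, time_pure]
      omega
  · split_ifs
    · simp only [samples_pure]
      omega
    · simp only [samples_bind, samples_pure]
      omega

theorem eval_stepNoCollision_bounds (b : ℕ → ℝ) (J j : ℕ) (B : Block ℝ) :
    (stepNoCollision J j B).eval b = B ∨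
      ((stepNoCollision J j B).eval b).len = B.len ∧
        ((stepNoCollision J j B).eval b).start = 2 ^ (j + 1) - B.len - B.start := by
  rw [stepNoCollision_eq]
  simp only [eval_bind]
  split_ifs
  · exact Or.inl rfl
  · rw [eval_bind, eval_pure]
    exact Or.inr ⟨rfl, rfl⟩

theorem stepCollisionOf_cost (b : ℕ → ℝ) (J j q : ℕ) (ε : ℝ) (B : Block ℝ) :
    (stepCollisionOf J j q ε B).time b ≤ (9 * q + 63) * 2 ^ q ∧
      (stepCollisionOf J j q ε B).samples b ≤ 2 * 2 ^ q := by
  have hQ : 1 ≤ 2 ^ q := Nat.one_le_two_pow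
  have hQQ : 1 ≤ 2 ^ q + 2 ^ q := by omega
  have hread : ∀ k, (B.read k).time b ≤ 1 ∧ (B.read k).samples b = 0 := fun k => by
    unfold Block.read
    split_ifs <;> simp
  have hquot : ∀ f zero y l, (signedQuotient j q f zero y l).time b ≤ 4 ∧
      (signedQuotient j q f zero y l).samples b = 0 := fun f zero y l => by
    simp only [signedQuotient, time_bind, samples_bind]
    split_ifs <;> simp
  have hthr : ∀ zero two (y z : Fin (2 ^ q) → ℝ) k,
      (thresholdedEntry ε zero two y z k).time b ≤ 6 ∧
      (thresholdedEntry ε zero two y z k).samples b = 0 := fun zero two y z k => by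
    have := time_absolute_le b ((y k.rev + z k) / two)
    simp only [thresholdedEntry, time_bind, samples_bind, eval_plus, eval_quot]
    split_ifs <;> simp <;> omega
  have hquery : ∀ (r : ℝ) (i : ℕ), (query i >>= fun s => times r s).time b ≤ 2 ∧
      (query i >>= fun s => times r s).samples b ≤ 1 := fun r i => by
    simp [time_bind, samples_bind]
  constructor
  · simp only [stepCollisionOf, time_bind, time_ticks, time_sqrtConst, time_natConst]
    refine (Nat.add_le_add_left
      (Nat.add_le_add (time_tabulate_le b (c := 1) _ fun k => (hread _).1) <|
      Nat.add_le_add_left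
      (Nat.add_le_add (time_tabulate_le b (c := 2) _ fun k => (hquery _ _).1) <|
      Nat.add_le_add (time_tabulate_le b (c := 2) _ fun k => (hquery _ _).1) <|
      Nat.add_le_add (time_tabulate_le b (c := 1) _ fun k => by simp) <|
      Nat.add_le_add (time_fastDCT4 b q _) <|
      Nat.add_le_add_left (Nat.add_le_add_left (Nat.add_le_add_left
      (Nat.add_le_add (time_tabulate_le b (c := 4) _ fun k => (hquot _ _ _ _).1) <|
      Nat.add_le_add (time_tabulate_le b (c := 6) _ fun k => (hthr _ _ _ _ _).1) <|
      Nat.add_le_add (time_tabulate_le b (c := 1) _ fun k => by simp) <|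
      Nat.add_le_add (time_tabulate_le b (c := 0) _ fun k => by simp) <|
      (time_findSupport b _ _ ε hQQ).1) _) _) _) _) _).trans ?_
    nlinarith
  · simp only [stepCollisionOf, samples_bind, samples_ticks, samples_sqrtConst, samples_natConst,
      samples_fastDCT4, (time_findSupport b _ _ ε hQQ).2, zero_add, add_zero]
    refine (Nat.add_le_add (samples_tabulate_eq_zero b _ fun k => (hread _).2).le <|
      Nat.add_le_add (samples_tabulate_le b (c := 1) _ fun k => (hquery _ _).2) <|
      Nat.add_le_add (samples_tabulate_le b (c := 1) _ fun k => (hquery _ _).2) <|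
      Nat.add_le_add (samples_tabulate_eq_zero b _ fun k => by simp).le <|
      Nat.add_le_add (samples_tabulate_eq_zero b _ fun k => (hquot _ _ _ _).2).le <|
      Nat.add_le_add (samples_tabulate_eq_zero b _ fun k => (hthr _ _ _ _ _).2).le <|
      Nat.add_le_add (samples_tabulate_eq_zero b _ fun k => by simp).le <|
      (samples_tabulate_eq_zero b _ fun k => by simp).le).trans ?_
    omega

theorem eval_stepCollisionOf_bounds (b : ℕ → ℝ) (J j q : ℕ) (ε : ℝ) (B : Block ℝ) :
    1 ≤ ((stepCollisionOf J j q ε B).eval b).len ∧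
      2 ^ j - 2 ^ q ≤ ((stepCollisionOf J j q ε B).eval b).start ∧
      ((stepCollisionOf J j q ε B).eval b).start + ((stepCollisionOf J j q ε B).eval b).len ≤
        2 ^ j - 2 ^ q + (2 ^ q + 2 ^ q) := by
  have hQQ : 1 ≤ 2 ^ q + 2 ^ q := by have := Nat.one_le_two_pow (n := q); omega
  have h : ∃ w, (stepCollisionOf J j q ε B).eval b =
      (findSupport (2 ^ j - 2 ^ q) (2 ^ q + 2 ^ q) w ε).eval b := by
    simp only [stepCollisionOf, eval_bind]
    exact ⟨_, rfl⟩
  obtain ⟨w, hw⟩ := h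
  obtain ⟨f, l, hfl, hl, he, -⟩ := eval_findSupport b (2 ^ j - 2 ^ q) w ε hQQ
  rw [hw, he]
  dsimp only
  omega

/-! ### The complete algorithm -/

/-- The body of the main loop. -/
def mainPass (J M L : ℕ) (ε : ℝ) {n : ℕ} (i : Fin n) (B : Block ℝ) : Prog ℝ (Block ℝ) :=
  if B.start + M < 2 ^ (L + (i : ℕ)) then stepNoCollision J (L + i) B
  else stepCollision J (L + i) ε B

theorem sparseDCT_eq (J M : ℕ) (ε : ℝ) : sparseDCT J M ε = ticks (startLevel J M + 1) >>= fun _ =>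
    initialStep J (startLevel J M) ε >>= fun B =>
    loop (J - startLevel J M) (mainPass J M (startLevel J M) ε) B := rfl

theorem startLevel_eq_of_lt {J M : ℕ} (h : startLevel J M < J) :
    startLevel J M = Nat.clog 2 M + 1 := by
  unfold startLevel at *
  omega

/-- The cost of the main loop, for every threshold. A collision step is executed at most once: it
returns a block that keeps a distance of at least `2^c` from both ends of the index range, where
`c = ⌈log₂ M⌉`; the steps without collision preserve this distance, and it excludes another
collision step. -/
theorem mainLoop_cost (b : ℕ → ℝ) {J M c L : ℕ} (ε : ℝ) (hc : c = Nat.clog 2 M)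
    (hL : L < J → L = c + 1) (hLc : L ≤ c + 1) (B : Block ℝ) (hB : 1 ≤ B.len)
    (hB' : B.start + B.len ≤ 2 ^ L) :
    (loop (J - L) (mainPass J M L ε) B).time b ≤
        (J - L) * (27 * 2 ^ (c + 1) + 1) + (9 * c + 63) * 2 ^ c ∧
      (loop (J - L) (mainPass J M L ε) B).samples b ≤ (J - L) * 2 ^ (c + 1) + 2 * 2 ^ c := by
  have hMc : M ≤ 2 ^ c := hc ▸ Nat.le_pow_clog one_lt_two _
  have hc2 : 2 ^ (c + 1) = 2 * 2 ^ c := pow_succ' 2 c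
  have key := loop_induction b (fun i B t a => 1 ≤ B.len ∧ B.len ≤ 2 ^ (c + 1) ∧
      B.start + B.len ≤ 2 ^ (L + i) ∧
      ((t ≤ i * (27 * 2 ^ (c + 1) + 1) ∧ a ≤ i * 2 ^ (c + 1)) ∨
        (2 ^ c ≤ B.start ∧ B.start + B.len + 2 ^ c ≤ 2 ^ (L + i) ∧
          t ≤ i * (27 * 2 ^ (c + 1) + 1) + (9 * c + 63) * 2 ^ c ∧
          a ≤ i * 2 ^ (c + 1) + 2 * 2 ^ c)))
      (n := J - L) (mainPass J M L ε) B
      ⟨hB, by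
        have := Nat.pow_le_pow_right two_pos hLc
        omega, by simpa using hB', Or.inl (by simp)⟩ (by
    rintro i B t a ⟨h1, h2, h3, h4⟩
    have hLJ : L = c + 1 := hL (by have := i.2; omega)
    have hj : 2 ^ (L + (i + 1)) = 2 * 2 ^ (L + (i : ℕ)) := by rw [← add_assoc, pow_succ']
    have hcj : 2 ^ (c + 1) ≤ 2 ^ (L + (i : ℕ)) := Nat.pow_le_pow_right two_pos (by omega)
    unfold mainPass
    by_cases hcol : B.start + M < 2 ^ (L + (i : ℕ))
    · rw [if_pos hcol]
      obtain ⟨ht, ha⟩ := stepNoCollision_cost b J (L + i) B h1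
      have hb := eval_stepNoCollision_bounds b J (L + i) B
      set B' := (stepNoCollision J (L + i) B).eval b
      have e1 : ((i : ℕ) + 1) * (27 * 2 ^ (c + 1) + 1) =
        i * (27 * 2 ^ (c + 1) + 1) + (27 * 2 ^ (c + 1) + 1) := by ring
      have e2 : ((i : ℕ) + 1) * 2 ^ (c + 1) = i * 2 ^ (c + 1) + 2 ^ (c + 1) := by ring
      rw [hj, e1, e2]
      rw [add_assoc, hj] at hb
      have hlen : B'.len = B.len := by
        rcases hb with hb | hb
        · rw [hb]
        · exact hb.1
      have hst : B'.start = B.start ∨ B'.start = 2 * 2 ^ (L + (i : ℕ)) - B.len - B.start := by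
        rcases hb with hb | hb
        · exact Or.inl (by rw [hb])
        · exact Or.inr hb.2
      clear hb e1 e2
      refine ⟨by omega, by omega, by omega, ?_⟩
      rcases h4 with h4 | h4
      · exact Or.inl ⟨by omega, by omega⟩
      · exact Or.inr ⟨by omega, by omega, by omega, by omega⟩
    · rw [if_neg hcol, stepCollision_eq]
      set q := Nat.clog 2 (2 ^ (L + (i : ℕ)) - B.start) with hq
      have hqc : q ≤ c := by
        rw [hq, hc]
        exact Nat.clog_mono_right 2 (by omega)
      have hQ : 2 ^ q ≤ 2 ^ c := Nat.pow_le_pow_right two_pos hqc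
      obtain ⟨ht, ha⟩ := stepCollisionOf_cost b J (L + i) q ε B
      obtain ⟨b1, b2, b3⟩ := eval_stepCollisionOf_bounds b J (L + i) q ε B
      have hqt : (9 * q + 63) * 2 ^ q ≤ (9 * c + 63) * 2 ^ c := Nat.mul_le_mul (by omega) hQ
      set B' := (stepCollisionOf J (L + i) q ε B).eval b
      have e1 : ((i : ℕ) + 1) * (27 * 2 ^ (c + 1) + 1) =
        i * (27 * 2 ^ (c + 1) + 1) + (27 * 2 ^ (c + 1) + 1) := by ring
      have e2 : ((i : ℕ) + 1) * 2 ^ (c + 1) = i * 2 ^ (c + 1) + 2 ^ (c + 1) := by ring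
      rw [hj, e1, e2]
      rcases h4 with h4 | h4
      · exact ⟨b1, by omega, by omega, Or.inr ⟨by omega, by omega, by omega, by omega⟩⟩
      · omega)
  obtain ⟨-, -, -, h | h⟩ := key
  · exact ⟨h.1.trans (Nat.le_add_right _ _), h.2.trans (Nat.le_add_right _ _)⟩
  · exact ⟨h.2.2.1, h.2.2.2⟩

theorem sparseDCT_cost (b : ℕ → ℝ) {J M c : ℕ} (ε : ℝ) (hc : c = Nat.clog 2 M) :
    (sparseDCT J M ε).time b ≤
        (25 * c + 127) * 2 ^ c + 55 * ((J - startLevel J M) * 2 ^ c) ∧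
      (sparseDCT J M ε).samples b ≤ 4 * 2 ^ c + 2 * ((J - startLevel J M) * 2 ^ c) := by
  have hLc : startLevel J M ≤ c + 1 := by rw [startLevel, hc]; exact min_le_left _ _
  have hL : startLevel J M < J → startLevel J M = c + 1 := fun h => hc ▸ startLevel_eq_of_lt h
  rw [sparseDCT_eq]
  set L := startLevel J M
  simp only [time_bind, samples_bind, time_ticks, samples_ticks]
  have h1 := time_initialStep b J L ε
  have h2 := samples_initialStep b J L ε
  obtain ⟨h3, h4⟩ := eval_initialStep_bounds b J L ε
  obtain ⟨h5, h6⟩ := mainLoop_cost b ε hc hL hLc _ h3 h4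
  have hpow : 2 ^ L ≤ 2 * 2 ^ c := by
    rw [← pow_succ']
    exact Nat.pow_le_pow_right two_pos hLc
  have hlt : L + 1 ≤ 2 ^ L := Nat.lt_two_pow_self
  have h7 : (8 * L + 22) * 2 ^ L ≤ (8 * (c + 1) + 22) * (2 * 2 ^ c) :=
    Nat.mul_le_mul (by omega) hpow
  have h8 : 1 ≤ 2 ^ c := Nat.one_le_two_pow
  have h9 : (J - L) * 1 ≤ (J - L) * 2 ^ c := Nat.mul_le_mul_left _ h8
  rw [pow_succ'] at h5 h6
  constructor
  · nlinarith
  · nlinarith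

/-- The main loop maintains the reflected periodizations. -/
theorem represents_sparseDCT {J m : ℕ} {x : Fin (2 ^ J) → ℝ} {μ ν : Fin (2 ^ J)} {ε : ℝ}
    (hx : IsShortSupport x m μ ν) (he : Even m → x μ + x ν ≠ 0) (hε : 0 ≤ ε)
    (hthr : ∀ d k : ℕ, d ≤ J - startLevel J m → reflectedPeriodization J x d k ≠ 0 →
      ε < |reflectedPeriodization J x d k|) :
    Represents J ((sparseDCT J m ε).eval (zeroExtend (dctII x)))
      (reflectedPeriodization J x 0) := by
  have hmJ : m ≤ 2 ^ J := by
    have := hx.length_eq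
    have := ν.2
    omega
  have hmL := le_two_pow_startLevel hmJ
  have hLJ : startLevel J m ≤ J := min_le_right _ _
  have hL := @startLevel_eq_of_lt J m
  rw [sparseDCT_eq, eval_bind, eval_bind]
  set L := startLevel J m with hLdef
  have hsupp := fun d (hd : d ≤ J - L) => exists_foldedSupport hx he hd
  have key := loop_invariant (zeroExtend (dctII x))
    (fun i B => Represents (L + i) B (reflectedPeriodization J x (J - (L + i)))) (n := J - L)
    (mainPass J m L ε) ((initialStep J L ε).eval (zeroExtend (dctII x))) ?_ ?_
  · rwa [Nat.add_sub_cancel' hLJ, Nat.sub_self] at key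
  · rw [add_zero]
    obtain ⟨a, b, h⟩ := hsupp (J - L) le_rfl
    refine represents_initialStep x hε hLJ (fun k hk => h.zero_outside k (Or.inr ?_))
      h.exists_ne_zero fun k => hthr _ k le_rfl
    have := h.lt
    rw [Nat.sub_sub_self hLJ] at this
    omega
  · intro i B hB
    obtain ⟨d, hd⟩ : ∃ d, J - (L + i) = d + 1 := ⟨J - (L + i) - 1, by omega⟩
    have hj : J - (d + 1) = L + i := by omega
    have hdj : J - d = L + i + 1 := by omega
    have hd' : J - (L + i) - 1 = d := by omega
    rw [hd] at hB
    rw [show J - (L + (i + 1)) = d by omega, ← add_assoc]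
    set f := reflectedPeriodization J x (d + 1)
    set X := reflectedPeriodization J x d with hXdef
    have hf : ∀ k, f k = if k < 2 ^ (L + (i : ℕ)) then X k + X (2 * 2 ^ (L + (i : ℕ)) - 1 - k)
        else 0 := fun k => by
      rw [← hj]
      exact reflectedPeriodization_succ x (by omega) k
    obtain ⟨a, b, h⟩ := hsupp d (by omega)
    have hne := h.exists_ne_zero
    rw [hdj, pow_succ', ← hXdef] at h
    have hX : ∀ k, 2 * 2 ^ (L + (i : ℕ)) ≤ k → X k = 0 := fun k hk =>
      h.zero_outside k (Or.inr (by have := h.lt; omega))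
    obtain ⟨-, hzero, hhalf⟩ :=
      h.fold (hmL.trans (Nat.pow_le_pow_right two_pos (by omega))) hf
    have hb : ∀ k < 2 ^ (L + (i : ℕ)), √((2 ^ (J - (L + i) - 1) : ℕ) : ℝ) *
        zeroExtend (dctII x) (2 ^ (J - (L + i) - 1) * (2 * k + 1)) =
        (∑ l ∈ Finset.range (2 ^ (L + (i : ℕ))), (X l - X (2 * 2 ^ (L + (i : ℕ)) - 1 - l)) *
          cosFour (2 ^ (L + (i : ℕ))) k l) / √((2 ^ (L + (i : ℕ)) : ℕ) : ℝ) := by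
      intro k hk
      have := sqrt_mul_zeroExtend_dctII x (d := d) (k := 2 * k + 1) (by omega)
        (by rw [hdj, pow_succ']; omega)
      rw [hd', this, hdj, if_neg (by omega), pow_succ' (2 : ℕ), sum_cosThree_odd, mul_one,
        pow_succ' (2 : ℝ), ← hXdef, ← div_div, div_self (two_ne_zero' ℝ),
        Real.sqrt_div one_pos.le, Real.sqrt_one]
      push_cast
      ring
    have hle := hB.le
    unfold mainPass
    split_ifs with hcol
    · exact represents_stepNoCollision hB hX hf hb (hhalf _ hB.first_ne hcol)
    · refine represents_stepCollision hε (by omega) hB hX hf hb ?_ (fun k hk => ?_) hne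
        fun k => hthr d k (by omega)
      · have : Nat.clog 2 (2 ^ (L + (i : ℕ)) - B.start) ≤ Nat.clog 2 m :=
          Nat.clog_mono_right 2 (by omega)
        have := hL (by omega)
        omega
      · have := hB.len_pos
        exact hzero k (by omega) fun l hl => hB.eq_zero (Or.inl (by omega))

theorem two_pow_clog_le {m : ℕ} (hm : 1 ≤ m) : 2 ^ Nat.clog 2 m ≤ 2 * m := by
  rcases Nat.lt_or_ge 1 m with h | h
  · have h1 := Nat.pow_pred_clog_lt_self one_lt_two h
    have h2 := Nat.clog_pos one_lt_two h
    rw [← Nat.succ_pred_eq_of_pos h2, pow_succ']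
    omega
  · obtain rfl : m = 1 := by omega
    simp

theorem mainTheorem4 :
    ∃ C : ℝ, 0 < C ∧
      ∀ (J m : ℕ) (x : Fin (2 ^ J) → ℝ) (μ ν : Fin (2 ^ J)) (ε : ℝ),
        1 ≤ J →
        IsShortSupport x m μ ν →
        (Even m → x μ + x ν ≠ 0) →
        0 ≤ ε →
        ((sparseDCT J m ε).time (zeroExtend (dctII x)) : ℝ) ≤
            C * (m * Real.log m + m * Real.logb 2 ((2 : ℝ) ^ J / m)) ∧
          ((sparseDCT J m ε).samples (zeroExtend (dctII x)) : ℝ) ≤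
            C * (m + m * Real.logb 2 ((2 : ℝ) ^ J / m)) ∧
          ((∀ d k : ℕ, d ≤ J - startLevel J m → reflectedPeriodization J x d k ≠ 0 →
              ε < |reflectedPeriodization J x d k|) →
            ∀ k : Fin (2 ^ J),
              ((sparseDCT J m ε).eval (zeroExtend (dctII x))).entry k = x k) := by
  -- The cost bounds add up to at most `354 m log₂ m + 414 m log₂ (N/m)`, and `log₂ m ≤ 2 log m`.
  refine ⟨1000, by norm_num, fun J m x μ ν ε hJ hx he hε => ?_⟩
  have hm : 1 ≤ m := by
    have := hx.length_eq
    have : (μ : ℕ) ≤ ν := hx.le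
    omega
  have hmJ : m ≤ 2 ^ J := by
    have := hx.length_eq
    have := ν.2
    omega
  obtain ⟨c, hc⟩ : ∃ c, c = Nat.clog 2 m := ⟨_, rfl⟩
  obtain ⟨ht, ha⟩ := sparseDCT_cost (zeroExtend (dctII x)) (J := J) ε hc
  have hm0 : (0 : ℝ) < m := by exact_mod_cast hm
  have hm1 : (1 : ℝ) ≤ m := by exact_mod_cast hm
  have hK : (2 : ℝ) ^ c ≤ 2 * m := by exact_mod_cast hc ▸ two_pow_clog_le hm
  have hK' : (m : ℝ) ≤ 2 ^ c := by exact_mod_cast hc ▸ Nat.le_pow_clog one_lt_two m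
  set ℓ := Real.logb 2 m with hℓ
  have hℓ0 : 0 ≤ ℓ := Real.logb_nonneg one_lt_two hm1
  have hh : Real.logb 2 ((2 : ℝ) ^ J / m) = J - ℓ := by
    rw [Real.logb_div (by positivity) hm0.ne', Real.logb_pow, Real.logb_self_eq_one one_lt_two,
      mul_one]
  have hcℓ : (c : ℝ) ≤ ℓ + 1 := by
    have := Real.logb_le_logb_of_le one_lt_two (by positivity) hK
    rw [Real.logb_pow, Real.logb_self_eq_one one_lt_two, mul_one,
      Real.logb_mul two_ne_zero hm0.ne', Real.logb_self_eq_one one_lt_two] at this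
    linarith
  have hℓc : ℓ ≤ c := by
    have := Real.logb_le_logb_of_le one_lt_two hm0 hK'
    rwa [Real.logb_pow, Real.logb_self_eq_one one_lt_two, mul_one] at this
  have hℓJ : ℓ ≤ J := by
    have : (m : ℝ) ≤ 2 ^ J := by exact_mod_cast hmJ
    have := Real.logb_le_logb_of_le one_lt_two hm0 this
    rwa [Real.logb_pow, Real.logb_self_eq_one one_lt_two, mul_one] at this
  have hlog : ℓ ≤ 2 * Real.log m := by
    rw [hℓ, Real.logb, div_le_iff₀ (Real.log_pos one_lt_two)]
    nlinarith [Real.log_two_gt_d9, Real.log_nonneg hm1]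
  have hn : ((J - startLevel J m : ℕ) : ℝ) ≤ J - ℓ := by
    rcases lt_or_ge (startLevel J m) J with h | h
    · rw [Nat.cast_sub h.le, startLevel_eq_of_lt h, ← hc]
      push_cast
      linarith
    · rw [Nat.sub_eq_zero_of_le h]
      simpa using hℓJ
  have hJ1 : (1 : ℝ) ≤ J := by exact_mod_cast hJ
  have hn0 : (0 : ℝ) ≤ ((J - startLevel J m : ℕ) : ℝ) := Nat.cast_nonneg _
  have hnK : ((J - startLevel J m : ℕ) : ℝ) * 2 ^ c ≤ (J - ℓ) * (2 * m) :=
    mul_le_mul hn hK (by positivity) (by linarith)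
  rw [hh]
  refine ⟨?_, ?_, fun hthr k => ?_⟩
  · have ht' : ((sparseDCT J m ε).time (zeroExtend (dctII x)) : ℝ) ≤
        (25 * c + 127) * 2 ^ c + 55 * (((J - startLevel J m : ℕ) : ℝ) * 2 ^ c) := by
      exact_mod_cast ht
    have h1 : (25 * (c : ℝ) + 127) * 2 ^ c ≤ (25 * (ℓ + 1) + 127 * J) * (2 * m) :=
      mul_le_mul (by linarith) hK (by positivity) (by positivity)
    have h2 : (m : ℝ) * ℓ ≤ m * (2 * Real.log m) := mul_le_mul_of_nonneg_left hlog hm0.le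
    have h3 : (m : ℝ) * 1 ≤ m * J := mul_le_mul_of_nonneg_left hJ1 hm0.le
    have h4 : (m : ℝ) * ℓ ≤ m * J := mul_le_mul_of_nonneg_left hℓJ hm0.le
    linarith
  · have ha' : ((sparseDCT J m ε).samples (zeroExtend (dctII x)) : ℝ) ≤
        4 * 2 ^ c + 2 * (((J - startLevel J m : ℕ) : ℝ) * 2 ^ c) := by
      exact_mod_cast ha
    have h4 : (m : ℝ) * ℓ ≤ m * J := mul_le_mul_of_nonneg_left hℓJ hm0.le
    linarith
  · rw [(represents_sparseDCT hx he hε hthr).entry, reflectedPeriodization, zeroExtend_of_lt x k.2]
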